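/- Consider the one-dimensional Euler equations $\partial_t U+\partial_x F(U)=0$, $U=(\rho,\rho u,\rho e)$, $F(U)=(\rho u,\rho u^2+p,u(\rho e+p))$, with $p=(\gamma-1)(\rho e-\tfrac12\rho u^2)$ and $\gamma=1.4$. Let $\nu(U)=|u|+\sqrt{\gamma p/\rho}$ and $s(U)=\ln p-\gamma\ln\rho+s_0$ with an arbitrary constant $s_0\in\mathbb R$. For $\lambda\in\mathbb R$ and $\hat n=\pm1$ the Lax–Friedrichs flux with dissipation coefficient $\lambda$ is $$\widehat F_\lambda(U^+,U^-,\hat n)=\tfrac12\bigl(F(U^+)+F(U^-)\bigr)\hat n-\tfrac12\lambda\,(U^--U^+).$$ Let $\Omega_e=[x_l,x_r]$ with $h=x_r-x_l>0$, let $\varphi_1,\dots,\varphi_{N_p}$ be real polynomials whose span contains the constants, and let $U_e=\sum_m \widetilde U_{m}\varphi_m$ with $\widetilde U_m\in\mathbb R^3$. Let $U_l^-$ and $U_r^-$ be the exterior traces at $x_l$ and $x_r$ (the values there of the solution on the neighbouring elements). Assume that $\rho>0$ and $p>0$ for $U_e(x)$, $x\in\Omega_e$, and for $U_l^-,U_r^-$.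 Let $x_q\in\Omega_e$, $w_q>0$ ($q=1,\dots,N_q$), $\sum_q w_q=1$, be a quadrature rule with $\frac1h\int_{\Omega_e}\varphi_m\,dx=\sum_q w_q\varphi_m(x_q)$ for all $m$. Choose $N_p$ of its points, $y_1,\dots,y_{N_p}$, such that the matrix $[\varphi_m(y_n)]$ is non-singular. For each selected quadrature point $x_q$ let $\phi_q$ be the corresponding Lagrange basis function of $\mathrm{span}\{\varphi_m\}$, i.e. the corresponding entry of $[\varphi_m(y_n)]^{-1}[\varphi_m(x)]$, and put $\phi_q=0$ for the quadrature points that are not selected. Let $\theta_l,\theta_r>0$ be such that $$\theta_q:=w_q-\theta_l\phi_q(x_l)-\theta_r\phi_q(x_r)\ge0\qquad\text{for all }q.$$ Let $\lambda_l\ge\max\{\nu(U_l^-),\nu(U_e(x_l))\}$, $\lambda_r\ge\max\{\nu(U_e(x_r)),\nu(U_r^-)\}$ and $\lambda\ge\max\{\lambda_l,\lambda_r\}$ (for instance $\lambda_l=\lambda_r=\lambda$ with $\lambda\ge\max\nu$ over the four interface traces), and let $\Delta t>0$ satisfy $$\frac{\Delta t\,\lambda}{h}\le\frac12\min\{\theta_l,\theta_r\}.$$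 Let $U_e^{\Delta t}=\sum_m\widetilde U_m^{\Delta t}\varphi_m$ be obtained by a forward Euler step of the DG weak form: for all $n$, $$\sum_m\frac{\widetilde U_m^{\Delta t}-\widetilde U_m}{\Delta t}\int_{\Omega_e}\varphi_n\varphi_m\,dx-\int_{\Omega_e}\varphi_n'F(U_e)\,dx+\varphi_n(x_l)\widehat F_{\lambda_l}(U_e(x_l),U_l^-,-1)+\varphi_n(x_r)\widehat F_{\lambda_r}(U_e(x_r),U_r^-,1)=0 .$$ Then the average $\overline U_e^{\Delta t}=\frac1h\int_{\Omega_e}U_e^{\Delta t}\,dx$ has positive density and pressure, the minimum below is attained, and $$s(\overline U_e^{\Delta t})\ \ge\ \min\bigl\{s(U)\;:\;U\in\{U_e(y):y\in\Omega_e\}\cup\{U_l^-,U_r^-\}\bigr\}.$$ -/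

import Mathlib

open Polynomial MeasureTheory

noncomputable section

namespace EntropyDG

/-! ### One-dimensional Euler equations for an ideal gas -/

/-- A conservative state `(ρ, ρ u, ρ e)` of the one-dimensional Euler equations. -/
abbrev State : Type := Fin 3 → ℝ

/-- The ratio of specific heats, `γ = 1.4`. -/
def gam : ℝ := 7 / 5

/-- The density `ρ`. -/
def density (U : State) : ℝ := U 0

/-- The velocity `u`. -/
def velocity (U : State) : ℝ := U 1 / U 0

/-- The pressure `p = (γ - 1) (ρ e - ρ u² / 2)`. -/
def pressure (U : State) : ℝ := (gam - 1) * (U 2 - density U * velocity U ^ 2 / 2)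

/-- A physical state: positive density and positive pressure. -/
def Admissible (U : State) : Prop := 0 < density U ∧ 0 < pressure U

/-- The Euler flux `F(U) = (ρ u, ρ u² + p, u (ρ e + p))`. -/
def flux (U : State) : State :=
  ![density U * velocity U,
    density U * velocity U ^ 2 + pressure U,
    velocity U * (U 2 + pressure U)]

/-- The speed of sound `c = √(γ p / ρ)`. -/
def soundSpeed (U : State) : ℝ := Real.sqrt (gam * pressure U / density U)

/-- The local maximum characteristic speed `ν = |u| + c`. -/
def waveSpeed (U : State) : ℝ := |velocity U| + soundSpeed U

/-- The physical entropy `s = ln p - γ ln ρ + s₀`, with reference entropy `s₀`. -/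
def entropy (s₀ : ℝ) (U : State) : ℝ :=
  Real.log (pressure U) - gam * Real.log (density U) + s₀

/-- The Lax–Friedrichs flux with dissipation coefficient `lam` at an interface with interior
state `Ui`, exterior state `Ue` and outward normal `n = ±1`. -/
def laxFriedrichs (lam : ℝ) (Ui Ue : State) (n : ℝ) : State :=
  (1 / 2 : ℝ) • (n • (flux Ui + flux Ue)) - (lam / 2) • (Ue - Ui)

/-! ### Discontinuous Galerkin discretization on one element `[xl, xr]` -/

/-- The discrete solution `∑ m, c m φ m (x)` with basis polynomials `φ m` and (vector-valued)
coefficients `c m`. -/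
def dgField {Np : ℕ} (φ : Fin Np → ℝ[X]) (c : Fin Np → State) (x : ℝ) : State :=
  ∑ m, (φ m).eval x • c m

/-- The average over the element `[xl, xr]`. -/
def cellAverage (xl xr : ℝ) (U : ℝ → State) : State :=
  (xr - xl)⁻¹ • ∫ x in xl..xr, U x

/-- One forward Euler step of size `dt` of the discontinuous Galerkin weak form on the element
`[xl, xr]`, from the coefficients `c` to the coefficients `c'`. `UL` and `UR` are the exterior
traces at `xl` and `xr`, and `lamL`, `lamR` are the dissipation coefficients of the
Lax–Friedrichs fluxes at these interfaces. -/
def IsForwardEulerStep {Np : ℕ} (xl xr : ℝ) (φ : Fin Np → ℝ[X]) (UL UR : State)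
    (lamL lamR dt : ℝ) (c c' : Fin Np → State) : Prop :=
  ∀ n : Fin Np,
    (∑ m, (∫ x in xl..xr, (φ n).eval x * (φ m).eval x) • (dt⁻¹ • (c' m - c m)))
      - (∫ x in xl..xr, (derivative (φ n)).eval x • flux (dgField φ c x))
      + ((φ n).eval xl • laxFriedrichs lamL (dgField φ c xl) UL (-1)
        + (φ n).eval xr • laxFriedrichs lamR (dgField φ c xr) UR 1) = 0

/-- A quadrature rule on `[xl, xr]` with points `xq` in the element and positive weights `w` of
total mass one, which gives the exact element average of every basis polynomial. -/
structure IsQuadrature {Np Nq : ℕ} (xl xr : ℝ) (φ : Fin Np → ℝ[X]) (w xq : Fin Nq → ℝ) :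
    Prop where
  mem : ∀ q, xq q ∈ Set.Icc xl xr
  pos : ∀ q, 0 < w q
  sum_one : ∑ q, w q = 1
  exact : ∀ m, (xr - xl)⁻¹ * (∫ x in xl..xr, (φ m).eval x) = ∑ q, w q * (φ m).eval (xq q)

/-- The matrix `[φ m (y n)]` of the values of the basis polynomials at the points `y n`. -/
def nodalMatrix {Np : ℕ} (φ : Fin Np → ℝ[X]) (y : Fin Np → ℝ) : Matrix (Fin Np) (Fin Np) ℝ :=
  Matrix.of fun m n => (φ m).eval (y n)

/-- The Lagrange basis functions of `span φ` for the points `y n`, as the vector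
`[φ m (y n)]⁻¹ [φ m (x)]`. -/
def lagrangeBasis {Np : ℕ} (φ : Fin Np → ℝ[X]) (y : Fin Np → ℝ) (n : Fin Np) (x : ℝ) : ℝ :=
  ((nodalMatrix φ y)⁻¹.mulVec fun m => (φ m).eval x) n

/-- The Lagrange basis function attached to the quadrature point `xq q`, when the interpolation
points are the quadrature points `xq (ι n)`; it is zero if `q` is not selected by `ι`. -/
def quadBasis {Np Nq : ℕ} (φ : Fin Np → ℝ[X]) (xq : Fin Nq → ℝ) (ι : Fin Np → Fin Nq)
    (q : Fin Nq) (x : ℝ) : ℝ :=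
  ∑ n, if ι n = q then lagrangeBasis φ (xq ∘ ι) n x else 0

/-- The coefficient `θ_q = w_q - θ_l φ_q(xl) - θ_r φ_q(xr)`. -/
def thetaQ {Np Nq : ℕ} (xl xr : ℝ) (φ : Fin Np → ℝ[X]) (w xq : Fin Nq → ℝ)
    (ι : Fin Np → Fin Nq) (θl θr : ℝ) (q : Fin Nq) : ℝ :=
  w q - θl * quadBasis φ xq ι q xl - θr * quadBasis φ xq ι q xr

end EntropyDG

end

noncomputable section

namespace EntropyDG

/-! Fix the least old entropy `sMin` and put `C = exp (sMin - s₀)`. The states with ρ > 0 and p ≥ C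
ρ^γ form a convex set (`convex_entropySet`), so it suffices to write the new average as a convex
combination of members. Testing with the constant 1 gives the evolution of the average
(`cellAverage_step`), and interpolation at the selected points writes the old average through point
values and the two interior traces (`cellAverage_eq_sum_thetaQ`). `interface_decomposition` absorbs
the numerical fluxes into three Lax–Friedrichs intermediate states, one of them an artificial state
between the two interior traces; the CFL condition makes all weights nonnegative.

Everything then rests on `interState_mem`: (U + V)/2 + (F(U) − F(V))/(2λ) stays in the set once λ ≥
ν(U), ν(V). These local speeds need not bound the exact Riemann fan, so averaging a Riemann solution
is not available, and the inequality is proved algebraically. Let r be the density of the mixture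
and P = C r^γ. In units of r, P and the impedance √(γPr), the energy surplus becomes `pairForm`, in
which the two states are coupled by their velocity jump. Completing a square with a free multiplier
k decouples them (`pairForm_ge`). The choice k = 0 works unless one state has scaled pressure at
most 1 and scaled mass flux a < 1. Then the other state must be compressed (`one_le_of_expanded`),
and k is either 0 or (1 − a) times the pressure defect (`dualBound_add_nonneg`). With α = 1 − a the
light state loses at most 3α³(2 − α)/16, and the compressed state carries enough mass flux to pay
for it.

Specific volumes are written as v⁵, so that τ^γ = v⁷ and all the estimates are polynomial. -/

/-! ### Scaled energy surplus and single-state bounds with zero multiplier -/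

/-- The scaled relative energy of a gas of specific volume `τ` and pressure `p` with respect to the
reference gas with `τ = p = 1`, for `γ = 7 / 5`. -/
def bregman (τ p : ℝ) : ℝ := 25 / 14 * (p * τ - 1) + 5 / 7 * (τ - 1)

/-- The scaled pressure defect with respect to the reference pressure `1`. -/
def pdef (p : ℝ) : ℝ := 5 / 7 * (1 - p)

/-- The contribution of a state with mass flux `a` to the energy surplus of a pair of states, for
the multiplier `k`; see `pairForm_ge`. -/
def dualBound (a τ p k : ℝ) : ℝ := a * (bregman τ p - k * (τ - 1)) - (pdef p - k) ^ 2 / (2 * a)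

theorem dualBound_zero_nonneg {a τ p : ℝ} (ha : 0 < a) (h : pdef p ^ 2 ≤ 2 * a ^ 2 * bregman τ p) :
    0 ≤ dualBound a τ p 0 := by
  have : dualBound a τ p 0 = (2 * a ^ 2 * bregman τ p - pdef p ^ 2) / (2 * a) := by
    unfold dualBound; field_simp; ring
  rw [this]
  exact div_nonneg (by linarith) (by positivity)

/-- The subcharacteristic bound `hav` replaces a² by p/τ; what remains involves the thermodynamic
state only. -/
theorem dualBound_zero_of_one_le {a v p : ℝ} (ha : 0 < a) (hv : 0 < v) (hp : 1 ≤ p)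
    (hpv : 1 ≤ p * v ^ 7) (hav : p ≤ a ^ 2 * v ^ 5) : 0 ≤ dualBound a (v ^ 5) p 0 := by
  apply dualBound_zero_nonneg ha
  have hτ : 0 < v ^ 5 := by positivity
  have hpt : 1 ≤ p * v ^ 5 := by
    rcases le_total v 1 with h | h
    · refine hpv.trans ?_
      have : v ^ 7 ≤ v ^ 5 := pow_le_pow_of_le_one hv.le h (by norm_num)
      nlinarith
    · have := one_le_pow₀ h (n := 5)
      nlinarith
  have key : (25 / 49) * (p - 1) ^ 2 * v ^ 5 ≤ 2 * p * bregman (v ^ 5) p := by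
    unfold bregman
    rcases le_total v 1 with h | h
    · obtain ⟨t, ht, rfl⟩ : ∃ t : ℝ, 0 ≤ t ∧ v = 1 / (1 + t) := by
        refine ⟨1 / v - 1, ?_, by field_simp; ring⟩
        have := one_le_one_div hv h
        linarith
      obtain ⟨s, hs, rfl⟩ : ∃ s : ℝ, 0 ≤ s ∧ p = (1 + t) ^ 7 + s := by
        refine ⟨p - (1 + t) ^ 7, ?_, by ring⟩
        have h1 : (1 / (1 + t)) ^ 7 = 1 / (1 + t) ^ 7 := by rw [one_div_pow]
        rw [h1, mul_one_div, le_div_iff₀ (by positivity)] at hpv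
        linarith
      rw [← sub_nonneg]
      have : 2 * ((1 + t) ^ 7 + s) * (25 / 14 * (((1 + t) ^ 7 + s) * (1 / (1 + t)) ^ 5 - 1) + 5 / 7 * ((1 / (1 + t)) ^ 5 - 1)) - (25 / 49) * ((1 + t) ^ 7 + s - 1) ^ 2 * (1 / (1 + t)) ^ 5
        = (2 * ((1 + t) ^ 7 + s) * (25 / 14 * (((1 + t) ^ 7 + s) - (1+t)^5) + 5 / 7 * (1 - (1+t)^5)) - (25 / 49) * ((1 + t) ^ 7 + s - 1) ^ 2 ) / (1 + t) ^ 5 := by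
        field_simp
      rw [this]
      apply div_nonneg _ (by positivity)
      ring_nf
      positivity
    · obtain ⟨t, ht, hvt⟩ : ∃ t : ℝ, 0 ≤ t ∧ v ^ 5 = 1 + t :=
        ⟨v ^ 5 - 1, by linarith [one_le_pow₀ h (n := 5)], by ring⟩
      obtain ⟨s, hs, rfl⟩ : ∃ s : ℝ, 0 ≤ s ∧ p = 1 + s := ⟨p - 1, by linarith, by ring⟩
      rw [hvt, ← sub_nonneg]
      ring_nf
      positivity
  have hD : 0 ≤ bregman (v ^ 5) p := by
    have : 0 ≤ (25 / 49) * (p - 1) ^ 2 * v ^ 5 := by positivity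
    by_contra hneg
    push Not at hneg
    nlinarith [mul_pos (show (0:ℝ) < p by linarith) (neg_pos.2 hneg)]
  have h2 : pdef p ^ 2 * v ^ 5 ≤ 2 * a ^ 2 * bregman (v ^ 5) p * v ^ 5 := by
    calc pdef p ^ 2 * v ^ 5 = (25 / 49) * (p - 1) ^ 2 * v ^ 5 := by unfold pdef; ring
      _ ≤ 2 * p * bregman (v ^ 5) p := key
      _ ≤ 2 * (a ^ 2 * v ^ 5) * bregman (v ^ 5) p := by gcongr
      _ = _ := by ring
  exact le_of_mul_le_mul_right h2 hτ

/-- Raising p lowers the defect and raises the relative energy, so the worst case is the isentropic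
pressure v⁻⁷, where one variable is left. -/
theorem pdef_sq_le_bregman {v p : ℝ} (hv : 1 ≤ v) (hp1 : p ≤ 1) (hpv : 1 ≤ p * v ^ 7) :
    pdef p ^ 2 ≤ 2 * bregman (v ^ 5) p := by
  obtain ⟨t, ht, rfl⟩ : ∃ t : ℝ, 0 ≤ t ∧ v = 1 + t := ⟨v - 1, by linarith, by ring⟩
  set q := 1 / (1 + t) ^ 7 with hq
  have hqp : q ≤ p := by rw [hq, div_le_iff₀ (by positivity)]; exact hpv
  have hq0 : 0 < q := by positivity
  have h0 : pdef q ^ 2 ≤ 2 * bregman ((1 + t) ^ 5) q := by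
    unfold pdef bregman
    rw [← sub_nonneg, hq]
    have : 2 * (25 / 14 * (1 / (1 + t) ^ 7 * (1 + t) ^ 5 - 1) + 5 / 7 * ((1 + t) ^ 5 - 1)) - (5 / 7 * (1 - 1 / (1 + t) ^ 7)) ^ 2
      = (14 * (1+t) ^ 19 - 54 * (1+t) ^ 14 + 35 * (1+t) ^ 12 + 10 * (1+t) ^ 7 - 5) * (5 / 49) / (1 + t) ^ 14 := by
      field_simp; ring
    rw [this]
    apply div_nonneg _ (by positivity)
    ring_nf
    positivity
  have hτ : 0 ≤ (1 + t) ^ 5 := by positivity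
  unfold pdef bregman at *
  nlinarith [mul_nonneg (sub_nonneg.2 hqp) hτ, mul_nonneg (sub_nonneg.2 hqp) (sub_nonneg.2 hp1)]

theorem dualBound_zero_of_le_one {a v p : ℝ} (ha : 1 ≤ a) (hv : 1 ≤ v) (hp1 : p ≤ 1)
    (hpv : 1 ≤ p * v ^ 7) : 0 ≤ dualBound a (v ^ 5) p 0 := by
  apply dualBound_zero_nonneg (by linarith)
  have h := pdef_sq_le_bregman hv hp1 hpv
  nlinarith [sq_nonneg (pdef p), mul_nonneg (show 0 ≤ a ^ 2 - 1 by nlinarith) ((sq_nonneg (pdef p)).trans h)]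

/-- The scaled internal energy surplus of the mixture of two streams with mass fluxes `a`, `b`,
specific volumes `τl`, `τr` and pressures `pl`, `pr`; see `energy_sub_eq_pairForm`. -/
def pairForm (a b τl τr pl pr : ℝ) : ℝ :=
  (a + b) * (a * bregman τl pl + b * bregman τr pr)
    + a * b * (b * (1 - τr) - a * (τl - 1)) ^ 2 / 2
    + (b * (1 - τr) - a * (τl - 1)) * (b * pdef pl + a * pdef pr)
    - (pdef pl - pdef pr) ^ 2 / 2

/-- The difference is a square over 2ab. The multiplier k is dual to the velocity jump, and any
choice of it separates the two states. -/
theorem pairForm_ge {a b τl τr pl pr : ℝ} (ha : 0 < a) (hb : 0 < b) (k : ℝ) :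
    (a + b) * (dualBound a τl pl k + dualBound b τr pr k) ≤ pairForm a b τl τr pl pr := by
  rw [← sub_nonneg]
  have : pairForm a b τl τr pl pr - (a + b) * (dualBound a τl pl k + dualBound b τr pr k)
      = (a * b * (b * (1 - τr) - a * (τl - 1)) + (b * pdef pl + a * pdef pr) - k * (a + b)) ^ 2
        / (2 * a * b) := by
    unfold pairForm dualBound
    field_simp
    ring
  rw [this]
  positivity

theorem pairForm_comm (a b τl τr pl pr : ℝ) :
    pairForm a b τl τr pl pr = pairForm b a τr τl pr pl := by
  unfold pairForm; ring

/-- If both states are expanded relative to the mixture, then the mass flux of the left one is at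
least `1`. -/
theorem one_le_of_expanded {a b v w pl pr : ℝ} (ha : 0 < a) (hb : 0 < b) (hv : 1 ≤ v) (hw : 1 ≤ w)
    (hplv : 1 ≤ pl * v ^ 7) (hprw : 1 ≤ pr * w ^ 7)
    (hbw : pr ≤ b ^ 2 * w ^ 5)
    (hS0 : 0 < a + b * (1 - w ^ 5)) (hS : pr * w ^ 5 ≤ (a + b * (1 - w ^ 5)) ^ 2)
    (hT0 : 0 < b + a * (1 - v ^ 5)) (hT : pl * v ^ 5 ≤ (b + a * (1 - v ^ 5)) ^ 2) : 1 ≤ a := by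
  have hv0 : 0 < v := by linarith
  have hw0 : 0 < w := by linarith
  have hS1 : 1 / w ≤ a + b * (1 - w ^ 5) := by
    apply le_of_sq_le_sq _ hS0.le
    refine le_trans ?_ hS
    rw [div_pow, div_le_iff₀ (by positivity)]
    nlinarith
  have hT1 : 1 / v ≤ b + a * (1 - v ^ 5) := by
    apply le_of_sq_le_sq _ hT0.le
    refine le_trans ?_ hT
    rw [div_pow, div_le_iff₀ (by positivity)]
    nlinarith
  have hb1 : 1 / w ^ 6 ≤ b := by
    apply le_of_sq_le_sq _ hb.le
    have : 1 ≤ b ^ 2 * w ^ 12 := by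
      calc 1 ≤ pr * w ^ 7 := hprw
        _ ≤ b ^ 2 * w ^ 5 * w ^ 7 := by gcongr
        _ = _ := by ring
    rw [div_pow, div_le_iff₀ (by positivity)]
    linarith
  have hw5 := one_le_pow₀ hw (n := 5)
  have hv5 := one_le_pow₀ hv (n := 5)
  -- `hS1` and `hb1` give a ≥ (2w⁵ − 1)/w⁶, which is at least 1 while w⁵ ≤ 1 + w + w² + w³ + w⁴,
  -- that is up to w ≈ 1.966. Beyond 19/10 one has a ≥ 15b, which `hT1` allows only for v⁵ < 2, and
  -- then b ≥ 1/2.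
  rcases le_total w (19 / 10) with h | h
  · have h1 : 1 / w + 1 / w ^ 6 * (w ^ 5 - 1) ≤ a := by
      nlinarith [mul_le_mul_of_nonneg_right hb1 (sub_nonneg.2 hw5)]
    refine le_trans ?_ h1
    have : 1 / w + 1 / w ^ 6 * (w ^ 5 - 1) = (2 * w ^ 5 - 1) / w ^ 6 := by field_simp; ring
    rw [this, le_div_iff₀ (by positivity)]
    have h4 : w ^ 5 ≤ 1 + w + w ^ 2 + w ^ 3 + w ^ 4 := by
      have h0 := sub_nonneg.2 h
      nlinarith [mul_nonneg h0 hw0.le, mul_nonneg h0 (pow_nonneg hw0.le 2),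
        mul_nonneg h0 (pow_nonneg hw0.le 3), mul_nonneg h0 (pow_nonneg hw0.le 4)]
    linear_combination mul_nonneg (sub_nonneg.2 hw) (sub_nonneg.2 h4)
  · have h16 : (16 : ℝ) ≤ w ^ 5 := by
      calc (16 : ℝ) ≤ (19 / 10) ^ 5 := by norm_num
        _ ≤ _ := by gcongr
    have h1 : b * 15 ≤ a := by
      have : 0 < 1 / w := by positivity
      nlinarith
    rcases le_total (v ^ 5) 2 with h2 | h2
    · have hv2 : v ≤ 2 := by
        by_contra hc
        push Not at hc
        have : (2 : ℝ) ^ 5 ≤ v ^ 5 := by gcongr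
        linarith
      have : 1 / 2 ≤ 1 / v := one_div_le_one_div_of_le hv0 hv2
      nlinarith
    · nlinarith

/-! ### The light expanded state, with mass flux 1 − α -/

/-- With k = α X, X the pressure defect, X − k is a multiple of the mass flux 1 − α, so the quotient
in `dualBound` disappears. -/
theorem dualBound_smul_pdef {al τ p : ℝ} (hal : al < 1) :
    dualBound (1 - al) τ p (al * pdef p)
      = (1 - al) * (bregman τ p - pdef p ^ 2 / 2 - al * pdef p * (τ - 1)) := by
  have : 1 - al ≠ 0 := by linarith
  unfold dualBound
  field_simp
  ring

theorem pow_mul_two_sub_mono {x y : ℝ} (hx : 0 ≤ x) (hxy : x ≤ y) (hy : y ≤ 1) :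
    x ^ 3 * (2 - x) ≤ y ^ 3 * (2 - y) := by
  have h : y ^ 3 * (2 - y) - x ^ 3 * (2 - x) =
      (y - x) * (2 * (y ^ 2 + x * y + x ^ 2) - (x + y) * (x ^ 2 + y ^ 2)) := by ring
  have h2 : (x + y) * (x ^ 2 + y ^ 2) ≤ 2 * (x ^ 2 + y ^ 2) := by
    apply mul_le_mul_of_nonneg_right (by linarith) (by positivity)
  have : 0 ≤ x * y := mul_nonneg hx (hx.trans hxy)
  nlinarith [mul_nonneg (sub_nonneg.2 hxy) (show 0 ≤ 2 * (y ^ 2 + x * y + x ^ 2) - (x + y) * (x ^ 2 + y ^ 2) by linarith)]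

/-- Removes α. AM–GM in the form 27G²(αE − G) ≤ 4(αE)³ is sharp at αE = 3G/2, and (1 − α)/(2 − α) is
largest at the left end α = G/E of the relevant range. -/
theorem tangent_bound {x al E G d : ℝ} (hal0 : 0 ≤ al) (hal1 : al ≤ 1) (hE : 0 < E) (hG : 0 ≤ G)
    (hGE : G < E) (h : 4 * x ^ 2 * E ^ 3 * (E - G) ≤ 81 / 16 * (2 * E - G) * G ^ 2 * d ^ 2) :
    (1 - al) * (al * E - G) * x ^ 2 ≤ 3 / 16 * al ^ 3 * (2 - al) * d ^ 2 := by
  rcases le_total (al * E) G with h1 | h1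
  · have h2 : 0 ≤ 3 / 16 * al ^ 3 * (2 - al) * d ^ 2 := by
      have : 0 ≤ 2 - al := by linarith
      positivity
    have : 0 ≤ (1 - al) * (G - al * E) * x ^ 2 :=
      mul_nonneg (mul_nonneg (by linarith) (by linarith)) (sq_nonneg x)
    linarith
  · have ht : 27 * G ^ 2 * (al * E - G) ≤ 4 * (al * E) ^ 3 := by
      have : 0 ≤ (al * E + 3 * G) * (2 * (al * E) - 3 * G) ^ 2 := by positivity
      linarith
    have h3 : (1 - al) * (2 * E - G) ≤ (2 - al) * (E - G) := by linarith
    have h1' : 0 ≤ al * E - G := by linarith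
    have hal1' : 0 ≤ 1 - al := by linarith
    have h2EG : 0 ≤ 2 * E - G := by linarith
    have h4 : (1 - al) * (al * E - G) * (4 * x ^ 2 * E ^ 3 * (E - G))
        ≤ (3 / 16 * al ^ 3 * (2 - al) * d ^ 2) * (4 * E ^ 3 * (E - G)) := by
      calc (1 - al) * (al * E - G) * (4 * x ^ 2 * E ^ 3 * (E - G))
          ≤ (1 - al) * (al * E - G) * (81 / 16 * (2 * E - G) * G ^ 2 * d ^ 2) :=
            mul_le_mul_of_nonneg_left h (mul_nonneg hal1' h1')
        _ = (27 * G ^ 2 * (al * E - G)) * (3 / 16 * ((1 - al) * (2 * E - G)) * d ^ 2) := by ring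
        _ ≤ (4 * (al * E) ^ 3) * (3 / 16 * ((2 - al) * (E - G)) * d ^ 2) := by gcongr
        _ = _ := by ring
    have hpos : 0 < 4 * E ^ 3 * (E - G) := mul_pos (by positivity) (by linarith)
    refine le_of_mul_le_mul_right ?_ hpos
    linarith

/-- Another elimination of α, used for strong expansion: the product (1 − α)(αE − G) is bounded by
its maximum, and α³(2 − α) from below by its value at α = G/E. -/
theorem endpoint_bound {x al E G d : ℝ} (hal0 : 0 ≤ al) (hal1 : al ≤ 1) (hE : 0 < E) (hG : 0 ≤ G)
    (h : 4 * x ^ 2 * E ^ 3 * (E - G) ^ 2 ≤ 3 * G ^ 3 * (2 * E - G) * d ^ 2) :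
    (1 - al) * (al * E - G) * x ^ 2 ≤ 3 / 16 * al ^ 3 * (2 - al) * d ^ 2 := by
  rcases le_total (al * E) G with h1 | h1
  · have h2 : 0 ≤ 3 / 16 * al ^ 3 * (2 - al) * d ^ 2 := by
      have : 0 ≤ 2 - al := by linarith
      positivity
    have : 0 ≤ (1 - al) * (G - al * E) * x ^ 2 :=
      mul_nonneg (mul_nonneg (by linarith) (by linarith)) (sq_nonneg x)
    linarith
  · have hr : G / E ≤ al := by rwa [div_le_iff₀ hE]
    have h2 := pow_mul_two_sub_mono (div_nonneg hG hE.le) hr hal1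
    have h3 : G ^ 3 * (2 * E - G) ≤ al ^ 3 * (2 - al) * E ^ 4 := by
      calc G ^ 3 * (2 * E - G) = (G / E) ^ 3 * (2 - G / E) * E ^ 4 := by field_simp
        _ ≤ _ := by gcongr
    have h5 : 4 * E * ((1 - al) * (al * E - G)) ≤ (E - G) ^ 2 := by
      nlinarith [sq_nonneg (2 * al * E - E - G)]
    have h4 : (1 - al) * (al * E - G) * x ^ 2 * (16 * E ^ 4)
        ≤ (3 / 16 * al ^ 3 * (2 - al) * d ^ 2) * (16 * E ^ 4) := by
      calc (1 - al) * (al * E - G) * x ^ 2 * (16 * E ^ 4)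
          = (4 * E * ((1 - al) * (al * E - G))) * (4 * x ^ 2 * E ^ 3) := by ring
        _ ≤ (E - G) ^ 2 * (4 * x ^ 2 * E ^ 3) := by gcongr
        _ = 4 * x ^ 2 * E ^ 3 * (E - G) ^ 2 := by ring
        _ ≤ 3 * G ^ 3 * (2 * E - G) * d ^ 2 := h
        _ = 3 * (G ^ 3 * (2 * E - G)) * d ^ 2 := by ring
        _ ≤ 3 * (al ^ 3 * (2 - al) * E ^ 4) * d ^ 2 := by gcongr
        _ = _ := by ring
    exact le_of_mul_le_mul_right h4 (by positivity)

/-- The right-hand bracket decreases in the defect, so an upper bound xN/d for the defect may be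
inserted. -/
theorem rational_lower {x p al N d : ℝ} (hx : 0 ≤ x) (hd : 0 < d) (hal0 : 0 ≤ al)
    (hX0 : 0 ≤ pdef p) (hX : pdef p * d ≤ x * N) :
    (5 / 2 * (x * (d - x * N) - x * N) * d - (x * N) ^ 2 / 2 - al * (x * N) * x * d)
      ≤ (bregman (1 + x) p - pdef p ^ 2 / 2 - al * pdef p * x) * d ^ 2 := by
  have hp : bregman (1 + x) p = 5 / 2 * (x * (1 - pdef p) - pdef p) := by
    unfold bregman pdef; ring
  rw [hp]
  set X := pdef p
  have h1 : 0 ≤ x * N - X * d := by linarith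
  have h2 : 0 ≤ X * d := by positivity
  have e : (5 / 2 * (x * (1 - X) - X) - X ^ 2 / 2 - al * X * x) * d ^ 2 - (5 / 2 * (x * (d - x * N) - x * N) * d - (x * N) ^ 2 / 2 - al * (x * N) * x * d) = (x * N - X * d) * (5 / 2 * (x + 1) * d + al * x * d + (x * N + X * d) / 2) := by ring
  have : 0 ≤ (x * N - X * d) * (5 / 2 * (x + 1) * d + al * x * d + (x * N + X * d) / 2) := by
    apply mul_nonneg h1
    have : 0 ≤ x * N := by linarith
    positivity
  linarith

/-- Comes from bounding v⁷ = (1 + x)^(7/5), x = v⁵ − 1, by its second-order Taylor polynomial at x =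
0. -/
theorem pdef_le_coarse {v p : ℝ} (hv : 1 ≤ v) (hpv : 1 ≤ p * v ^ 7) :
    pdef p * (5 + 7 * (v ^ 5 - 1) + 7 / 5 * (v ^ 5 - 1) ^ 2) ≤ (v ^ 5 - 1) * (5 + (v ^ 5 - 1)) := by
  have hx : 0 ≤ v ^ 5 - 1 := by linarith [one_le_pow₀ hv (n := 5)]
  have hv0 : 0 < v := by linarith
  have key : 5 * v ^ 7 ≤ 5 + 7 * (v ^ 5 - 1) + 7 / 5 * (v ^ 5 - 1) ^ 2 := by
    obtain ⟨t, ht, rfl⟩ : ∃ t : ℝ, 0 ≤ t ∧ v = 1 + t := ⟨v - 1, by linarith, by ring⟩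
    rw [← sub_nonneg]
    ring_nf
    positivity
  have hp0 : 0 < p := by
    by_contra hc
    push Not at hc
    nlinarith [pow_pos hv0 7]
  have : 5 ≤ p * (5 + 7 * (v ^ 5 - 1) + 7 / 5 * (v ^ 5 - 1) ^ 2) := by
    calc (5 : ℝ) ≤ 5 * (p * v ^ 7) := by linarith
      _ = p * (5 * v ^ 7) := by ring
      _ ≤ _ := by gcongr
  unfold pdef
  linarith

/-- Here (1 + x)^(7/5) is bounded by a rational function of type [2/1] with the same second-order
expansion. It is sharper than the Taylor polynomial, but is used on a bounded range only. -/
theorem pdef_le_fine {v p : ℝ} (hv : 1 ≤ v) (hv2 : v ^ 5 ≤ 13 / 2) (hpv : 1 ≤ p * v ^ 7) :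
    pdef p * (5 + 38 / 5 * (v ^ 5 - 1) + 56 / 25 * (v ^ 5 - 1) ^ 2)
      ≤ (v ^ 5 - 1) * (5 + 8 / 5 * (v ^ 5 - 1)) := by
  have hx : 0 ≤ v ^ 5 - 1 := by linarith [one_le_pow₀ hv (n := 5)]
  have hv0 : 0 < v := by linarith
  have hv3 : v ≤ 73 / 50 := by
    by_contra hc
    push Not at hc
    have : (73 / 50 : ℝ) ^ 5 ≤ v ^ 5 := by gcongr
    norm_num at this
    linarith
  have key : (5 + 3 / 5 * (v ^ 5 - 1)) * v ^ 7 ≤ 5 + 38 / 5 * (v ^ 5 - 1) + 56 / 25 * (v ^ 5 - 1) ^ 2 := by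
    rcases eq_or_lt_of_le hv with rfl | hv1
    · norm_num
    -- Maps 1 < v ≤ 73/50 onto t ≥ 0.
    obtain ⟨t, ht, rfl⟩ : ∃ t : ℝ, 0 ≤ t ∧ v = 1 + (23 / 50) / (1 + t) := by
      have h1 : 0 < v - 1 := by linarith
      refine ⟨(23 / 50) / (v - 1) - 1, ?_, ?_⟩
      · rw [sub_nonneg, le_div_iff₀ h1]; linarith
      · field_simp; ring
    rw [← sub_nonneg]
    have : 5 + 38 / 5 * ((1 + (23 / 50) / (1 + t)) ^ 5 - 1) + 56 / 25 * ((1 + (23 / 50) / (1 + t)) ^ 5 - 1) ^ 2 - (5 + 3 / 5 * ((1 + (23 / 50) / (1 + t)) ^ 5 - 1)) * (1 + (23 / 50) / (1 + t)) ^ 7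
      = (5 * (1 + t) ^ 12 + 38 / 5 * ((1 + t + 23 / 50) ^ 5 - (1 + t) ^ 5) * (1 + t) ^ 7 + 56 / 25 * ((1 + t + 23 / 50) ^ 5 - (1 + t) ^ 5) ^ 2 * (1 + t) ^ 2 - (5 * (1 + t) ^ 5 + 3 / 5 * ((1 + t + 23 / 50) ^ 5 - (1 + t) ^ 5)) * (1 + t + 23 / 50) ^ 7) / (1 + t) ^ 12 := by
      have h0 : (1 : ℝ) + (23 / 50) / (1 + t) = (1 + t + 23 / 50) / (1 + t) := by field_simp
      rw [h0, div_pow, div_pow]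
      have : (1 + t) ≠ 0 := by positivity
      field_simp
    rw [this]
    apply div_nonneg _ (by positivity)
    ring_nf
    positivity
  have hp0 : 0 < p := by
    by_contra hc
    push Not at hc
    nlinarith [pow_pos hv0 7]
  have : 5 + 3 / 5 * (v ^ 5 - 1) ≤ p * (5 + 38 / 5 * (v ^ 5 - 1) + 56 / 25 * (v ^ 5 - 1) ^ 2) := by
    calc 5 + 3 / 5 * (v ^ 5 - 1) = 1 * (5 + 3 / 5 * (v ^ 5 - 1)) := by ring
      _ ≤ (p * v ^ 7) * (5 + 3 / 5 * (v ^ 5 - 1)) := by gcongr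
      _ = p * ((5 + 3 / 5 * (v ^ 5 - 1)) * v ^ 7) := by ring
      _ ≤ _ := by gcongr
  unfold pdef
  linarith

/-- The worst loss of a light state, uniformly in its pressure and volume. Weak expansion uses the
fine bound with `tangent_bound`, strong expansion the coarse one with `endpoint_bound`. -/
theorem dualBound_left_ge {v p al : ℝ} (hal0 : 0 ≤ al) (hal1 : al < 1) (hv : 1 ≤ v) (hp1 : p ≤ 1)
    (hpv : 1 ≤ p * v ^ 7) :
    -(3 / 16 * al ^ 3 * (2 - al)) ≤ dualBound (1 - al) (v ^ 5) p (al * pdef p) := by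
  have hx : 0 ≤ v ^ 5 - 1 := by linarith [one_le_pow₀ hv (n := 5)]
  have hX0 : 0 ≤ pdef p := by unfold pdef; linarith
  rw [dualBound_smul_pdef hal1]
  have hva : v ^ 5 = 1 + (v ^ 5 - 1) := by ring
  rcases le_total (v ^ 5) (13 / 2) with h | h
  · have h1 := pdef_le_fine hv h hpv
    set x := v ^ 5 - 1
    rw [hva]
    have hx2 : x ≤ 11 / 2 := by linarith
    set d := 5 + 38 / 5 * x + 56 / 25 * x ^ 2 with hd
    have hd0 : 0 < d := by positivity
    have h2 := rational_lower hx hd0 hal0 hX0 h1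
    -- The inserted rational bound turns the bracket into (G − αE) x²/d², with these E and G; see
    -- `e` below.
    have h3 := @tangent_bound x al ((5 + 8 / 5 * x) * d) (19 * x + 412 / 25 * x ^ 2 + 448 / 125 * x ^ 3) d hal0 hal1.le (by positivity) (by positivity) (by rw [← sub_pos, hd]; ring_nf; positivity) (by
      rcases eq_or_lt_of_le hx with h0 | hx0
      · rw [← h0]; norm_num
      obtain ⟨t, ht, hxt⟩ : ∃ t : ℝ, 0 ≤ t ∧ x = (11 / 2) / (1 + t) := by
        refine ⟨(11 / 2) / x - 1, ?_, ?_⟩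
        · rw [sub_nonneg, le_div_iff₀ hx0]; linarith
        · field_simp; ring
      have hbase : 0 ≤ 81 / 16 * (2 * ((5 + 8 / 5 * x) * d) - (19 * x + 412 / 25 * x ^ 2 + 448 / 125 * x ^ 3)) * (19 + 412 / 25 * x + 448 / 125 * x ^ 2) ^ 2 - 4 * (5 + 8 / 5 * x) ^ 3 * d * (25 + 27 * x + 172 / 25 * x ^ 2) := by
        rw [hd, hxt]
        have e : ∀ s : ℝ, s ≠ 0 → 81 / 16 * (2 * ((5 + 8 / 5 * (11 / 2 / s)) * (5 + 38 / 5 * (11 / 2 / s) + 56 / 25 * (11 / 2 / s) ^ 2)) - (19 * (11 / 2 / s) + 412 / 25 * (11 / 2 / s) ^ 2 + 448 / 125 * (11 / 2 / s) ^ 3)) * (19 + 412 / 25 * (11 / 2 / s) + 448 / 125 * (11 / 2 / s) ^ 2) ^ 2 - 4 * (5 + 8 / 5 * (11 / 2 / s)) ^ 3 * (5 + 38 / 5 * (11 / 2 / s) + 56 / 25 * (11 / 2 / s) ^ 2) * (25 + 27 * (11 / 2 / s) + 172 / 25 * (11 / 2 / s) ^ 2)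
          = (81 / 16 * (2 * ((5 * s + 8 / 5 * (11 / 2)) * (5 * s ^ 2 + 38 / 5 * (11 / 2) * s + 56 / 25 * (11 / 2) ^ 2)) - (19 * (11 / 2) * s ^ 2 + 412 / 25 * (11 / 2) ^ 2 * s + 448 / 125 * (11 / 2) ^ 3)) * (19 * s ^ 2 + 412 / 25 * (11 / 2) * s + 448 / 125 * (11 / 2) ^ 2) ^ 2 - 4 * (5 * s + 8 / 5 * (11 / 2)) ^ 3 * (5 * s ^ 2 + 38 / 5 * (11 / 2) * s + 56 / 25 * (11 / 2) ^ 2) * (25 * s ^ 2 + 27 * (11 / 2) * s + 172 / 25 * (11 / 2) ^ 2)) / s ^ 7 := by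
          intro s hs
          field_simp
        rw [e (1 + t) (by positivity)]
        apply div_nonneg _ (by positivity)
        ring_nf
        positivity
      have := mul_nonneg (show 0 ≤ x ^ 2 * d ^ 2 by positivity) hbase
      have e2 : (5 + 8 / 5 * x) * d - (19 * x + 412 / 25 * x ^ 2 + 448 / 125 * x ^ 3) = 25 + 27 * x + 172 / 25 * x ^ 2 := by rw [hd]; ring
      rw [e2]
      linarith)
    have e : (5 / 2 * (x * (d - x * (5 + 8 / 5 * x)) - x * (5 + 8 / 5 * x)) * d - (x * (5 + 8 / 5 * x)) ^ 2 / 2 - al * (x * (5 + 8 / 5 * x)) * x * d)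
        = (19 * x + 412 / 25 * x ^ 2 + 448 / 125 * x ^ 3 - al * ((5 + 8 / 5 * x) * d)) * x ^ 2 := by
      rw [hd]; ring
    rw [e] at h2
    have h4 := mul_le_mul_of_nonneg_left h2 (show 0 ≤ 1 - al by linarith)
    refine le_of_mul_le_mul_right ?_ (show 0 < d ^ 2 by positivity)
    linarith
  · have h1 := pdef_le_coarse hv hpv
    set x := v ^ 5 - 1
    rw [hva]
    have hx2 : 11 / 2 ≤ x := by linarith
    set d := 5 + 7 * x + 7 / 5 * x ^ 2 with hd
    have hd0 : 0 < d := by positivity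
    have h2 := rational_lower hx hd0 hal0 hX0 h1
    have h3 := @endpoint_bound x al ((5 + x) * d) (35 / 2 * x + 10 * x ^ 2 + 7 / 5 * x ^ 3) d hal0 hal1.le (by positivity) (by positivity) (by
      have hbase : 0 ≤ 3 * (35 / 2 * x + 10 * x ^ 2 + 7 / 5 * x ^ 3) ^ 3 * (2 * ((5 + x) * d) - (35 / 2 * x + 10 * x ^ 2 + 7 / 5 * x ^ 3)) - 4 * x ^ 2 * (5 + x) ^ 3 * d * (25 + 45 / 2 * x + 4 * x ^ 2) ^ 2 := by
        obtain ⟨t, ht, hxt⟩ : ∃ t : ℝ, 0 ≤ t ∧ x = 11 / 2 + t := ⟨x - 11 / 2, by linarith, by ring⟩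
        rw [hd, hxt]
        ring_nf
        positivity
      have := mul_nonneg (show 0 ≤ d ^ 2 by positivity) hbase
      have e2 : (5 + x) * d - (35 / 2 * x + 10 * x ^ 2 + 7 / 5 * x ^ 3) = 25 + 45 / 2 * x + 4 * x ^ 2 := by rw [hd]; ring
      rw [e2]
      linarith)
    have e : (5 / 2 * (x * (d - x * (5 + x)) - x * (5 + x)) * d - (x * (5 + x)) ^ 2 / 2 - al * (x * (5 + x)) * x * d)
        = (35 / 2 * x + 10 * x ^ 2 + 7 / 5 * x ^ 3 - al * ((5 + x) * d)) * x ^ 2 := by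
      rw [hd]; ring
    rw [e] at h2
    have h4 := mul_le_mul_of_nonneg_left h2 (show 0 ≤ 1 - al by linarith)
    refine le_of_mul_le_mul_right ?_ (show 0 < d ^ 2 by positivity)
    linarith

/-- When the defect X is at least 2α, the mass flux is at least 1 − X/2, so α drops out and the zero
multiplier suffices. -/
theorem dualBound_left_zero {v p al : ℝ} (hal1 : al < 1) (hv : 1 ≤ v) (hp1 : p ≤ 1)
    (hpv : 1 ≤ p * v ^ 7) (hX : 2 * al ≤ pdef p) : 0 ≤ dualBound (1 - al) (v ^ 5) p 0 := by
  have hx : 0 ≤ v ^ 5 - 1 := by linarith [one_le_pow₀ hv (n := 5)]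
  have hX0 : 0 ≤ pdef p := by unfold pdef; linarith
  have hX1 : pdef p < 1 := by
    have : 0 < p := by
      by_contra hc
      push Not at hc
      have : 0 < v ^ 7 := by positivity
      nlinarith
    unfold pdef; linarith
  apply dualBound_zero_nonneg (by linarith)
  have h1 := pdef_le_coarse hv hpv
  have hva : v ^ 5 = 1 + (v ^ 5 - 1) := by ring
  set x := v ^ 5 - 1
  rw [hva]
  have hp : bregman (1 + x) p = 5 / 2 * (x * (1 - pdef p) - pdef p) := by
    unfold bregman pdef; ring
  rw [hp]
  set X := pdef p
  set d := 5 + 7 * x + 7 / 5 * x ^ 2 with hd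
  have hd0 : 0 < d := by positivity
  have hB : 5 / 2 * x ^ 2 * (1 + 2 / 5 * x) ≤ 5 / 2 * (x * (1 - X) - X) * d := by
    have : 5 / 2 * (x + 1) * (X * d) ≤ 5 / 2 * (x + 1) * (x * (5 + x)) := by gcongr
    rw [hd] at this ⊢
    linarith
  have hA : d - x * (5 + x) / 2 ≤ (1 - X / 2) * d := by linarith
  have hA0 : 0 ≤ d - x * (5 + x) / 2 := by rw [hd]; ring_nf; positivity
  have hpoly : (x * (5 + x)) ^ 2 * d ≤ 2 * (d - x * (5 + x) / 2) ^ 2 * (5 / 2 * x ^ 2 * (1 + 2 / 5 * x)) := by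
    rw [← sub_nonneg, hd]
    ring_nf
    positivity
  have h5 : X ^ 2 * d ^ 3 ≤ 2 * (1 - X / 2) ^ 2 * (5 / 2 * (x * (1 - X) - X)) * d ^ 3 := by
    calc X ^ 2 * d ^ 3 = (X * d) ^ 2 * d := by ring
      _ ≤ (x * (5 + x)) ^ 2 * d := by gcongr
      _ ≤ 2 * (d - x * (5 + x) / 2) ^ 2 * (5 / 2 * x ^ 2 * (1 + 2 / 5 * x)) := hpoly
      _ ≤ 2 * ((1 - X / 2) * d) ^ 2 * (5 / 2 * (x * (1 - X) - X) * d) := by gcongr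
      _ = _ := by ring
  have h6 := le_of_mul_le_mul_right h5 (show 0 < d ^ 3 by positivity)
  refine h6.trans ?_
  have hBr : 0 ≤ 5 / 2 * (x * (1 - X) - X) := by
    have : 0 ≤ 5 / 2 * (x * (1 - X) - X) * d := le_trans (by positivity) hB
    exact nonneg_of_mul_nonneg_left this hd0
  have h7 : 1 - X / 2 ≤ 1 - al := by linarith
  have h8 : 0 ≤ 1 - X / 2 := by linarith
  gcongr

/-- For a weak pressure defect the loss is quadratic in it; this replaces the uniform bound where
the latter is too pessimistic. -/
theorem dualBound_left_ge_of_small {v p al : ℝ} (hal0 : 0 ≤ al) (hal1 : al < 1) (hv : 1 ≤ v)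
    (hp1 : p ≤ 1) (hpv : 1 ≤ p * v ^ 7) (hX : pdef p ≤ 2 / 5) :
    -(9 / 5 * (1 - al) * al * pdef p ^ 2) ≤ dualBound (1 - al) (v ^ 5) p (al * pdef p) := by
  have hX0 : 0 ≤ pdef p := by unfold pdef; linarith
  rw [dualBound_smul_pdef hal1]
  have h1 := pdef_sq_le_bregman hv hp1 hpv
  have hp : bregman (v ^ 5) p = 5 / 2 * ((v ^ 5 - 1) * (1 - pdef p) - pdef p) := by
    unfold bregman pdef; ring
  rw [hp] at h1 ⊢
  set X := pdef p
  set x := v ^ 5 - 1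
  have h2 : X + X ^ 2 / 5 ≤ x * (1 - X) := by linarith
  have h3 : -(9 / 5 * al * X ^ 2) ≤ 5 / 2 * (x * (1 - X) - X) - X ^ 2 / 2 - al * X * x := by
    have hc : 0 ≤ 5 / 2 * (1 - X) - al * X := by nlinarith
    have h4 := mul_le_mul_of_nonneg_right h2 hc
    have h5 : X + X ^ 2 / 5 ≤ 9 / 5 * X * (1 - X) := by nlinarith
    have h6 := mul_le_mul_of_nonneg_right h5 (mul_nonneg hal0 hX0)
    refine le_of_mul_le_mul_right ?_ (show 0 < 1 - X by linarith)
    linarith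
  have := mul_le_mul_of_nonneg_left h3 (show 0 ≤ 1 - al by linarith)
  linarith

/-! ### The compressed state -/

theorem dualBound_mono_pressure {b τ p p₀ k : ℝ} (hb : 0 < b) (hk1 : k ≤ 1)
    (hp₀ : 1 ≤ p₀) (hp : p₀ ≤ p) (hbτ : p ≤ b ^ 2 * τ) :
    dualBound b τ p₀ k ≤ dualBound b τ p k := by
  have e : dualBound b τ p k - dualBound b τ p₀ k
      = (p - p₀) * (25 / 7 * (b ^ 2 * τ) - 25 / 49 * (p + p₀ - 2) - 10 / 7 * k) / (2 * b) := by
    unfold dualBound bregman pdef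
    field_simp
    ring
  rw [← sub_nonneg, e]
  apply div_nonneg (mul_nonneg (by linarith) (by linarith)) (by positivity)

theorem dualBound_mono_mass {b b' τ p k : ℝ} (hb : 0 < b) (hbb : b ≤ b')
    (h : 0 ≤ bregman τ p - k * (τ - 1)) : dualBound b τ p k ≤ dualBound b' τ p k := by
  unfold dualBound
  have h1 : (pdef p - k) ^ 2 / (2 * b') ≤ (pdef p - k) ^ 2 / (2 * b) := by gcongr
  have h2 := mul_le_mul_of_nonneg_right hbb h
  linarith

/-- This is `dualBound (u ^ 6) (1 / u ^ 5) (u ^ 7) 0`: an isentropically compressed state at the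
sonic mass flux u⁶. -/
def rarefactionExcess (u : ℝ) : ℝ :=
  (150 * u ^ 14 - 245 * u ^ 12 + 120 * u ^ 7 - 25) / (98 * u ^ 6)

theorem rarefactionExcess_nonneg {u : ℝ} (hu : 1 ≤ u) : 0 ≤ rarefactionExcess u := by
  obtain ⟨t, ht, rfl⟩ : ∃ t : ℝ, 0 ≤ t ∧ u = 1 + t := ⟨u - 1, by linarith, by ring⟩
  apply div_nonneg _ (by positivity)
  ring_nf
  positivity

/-- The loss function 3α³(2 − α)/16 at α = u⁶ − 2u + 1, the value at which the two lower bounds for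
the mass flux of the compressed state coincide. -/
theorem rarefactionExcess_ge {u : ℝ} (hu : 1 ≤ u) (hu2 : u ^ 5 ≤ 2) :
    3 / 16 * (u ^ 6 - 2 * u + 1) ^ 3 * (2 - (u ^ 6 - 2 * u + 1)) ≤ rarefactionExcess u := by
  have h1 : u ≤ 23 / 20 := by
    by_contra hc
    push Not at hc
    have : (23 / 20) ^ 5 ≤ u ^ 5 := by gcongr
    norm_num at this
    linarith
  rcases eq_or_lt_of_le hu with rfl | hu1
  · norm_num [rarefactionExcess]
  obtain ⟨t, ht, rfl⟩ : ∃ t : ℝ, 0 ≤ t ∧ u = (1 + t + 3 / 20) / (1 + t) := by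
    have h2 : 0 < u - 1 := by linarith
    refine ⟨(3 / 20) / (u - 1) - 1, ?_, ?_⟩
    · rw [sub_nonneg, le_div_iff₀ h2]; linarith
    · field_simp; ring
  unfold rarefactionExcess
  rw [le_div_iff₀ (by positivity), ← sub_nonneg]
  have e : ∀ r s : ℝ, s ≠ 0 → 150 * (r / s) ^ 14 - 245 * (r / s) ^ 12 + 120 * (r / s) ^ 7 - 25
      - 3 / 16 * ((r / s) ^ 6 - 2 * (r / s) + 1) ^ 3 * (2 - ((r / s) ^ 6 - 2 * (r / s) + 1))
        * (98 * (r / s) ^ 6)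
      = (150 * r ^ 14 * s ^ 16 - 245 * r ^ 12 * s ^ 18 + 120 * r ^ 7 * s ^ 23 - 25 * s ^ 30
        - 147 / 8 * (r ^ 6 - 2 * r * s ^ 5 + s ^ 6) ^ 3 * (2 * r * s ^ 5 + s ^ 6 - r ^ 6) * r ^ 6)
        / s ^ 30 := by
    intro r s hs
    field_simp
    ring
  rw [e _ (1 + t) (by positivity)]
  apply div_nonneg _ (by positivity)
  ring_nf
  positivity

/-- 3/16 is the loss function at α = 1, its largest value on [0, 1]. -/
theorem rarefactionExcess_ge_of_two_le {u : ℝ} (hu : 1 ≤ u) (hu2 : 2 ≤ u ^ 5) :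
    3 / 16 ≤ rarefactionExcess u := by
  have h1 : 1148 / 1000 ≤ u := by
    by_contra hc
    push Not at hc
    have : u ^ 5 ≤ (1148 / 1000) ^ 5 := by gcongr
    norm_num at this
    linarith
  obtain ⟨t, ht, rfl⟩ : ∃ t : ℝ, 0 ≤ t ∧ u = 1148 / 1000 + t := ⟨u - 1148 / 1000, by linarith, by ring⟩
  unfold rarefactionExcess
  rw [le_div_iff₀ (by positivity), ← sub_nonneg]
  ring_nf
  positivity

/-- Here σ is the mass flux times 1 − u⁻⁵, and σ = u⁶ − u is the sonic case. The identity `e`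
separates the sonic excess from a gain proportional to σ² − (u⁶ − u)²; the negative part of the last
term only reduces k to k/u⁵ in that gain. -/
theorem dualBound_right_ge {u σ k : ℝ} (hu : 1 < u) (hσ : u ^ 6 - u ≤ σ) (hk0 : 0 ≤ k)
    (hk : k ≤ 2 * σ ^ 2) :
    (σ ^ 2 - (u ^ 6 - u) ^ 2) / σ * ((u ^ 5 - 1) / (2 * u ^ 5) + k / u ^ 5) + rarefactionExcess u
      ≤ dualBound (σ * u ^ 5 / (u ^ 5 - 1)) (1 / u ^ 5) (u ^ 7) k := by
  have hu0 : 0 < u := by linarith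
  have hn : 0 < u ^ 5 - 1 := by linarith [one_lt_pow₀ hu (n := 5) (by norm_num)]
  have hz : 0 < u ^ 6 - u := by
    have : u ^ 6 - u = u * (u ^ 5 - 1) := by ring
    rw [this]; positivity
  have hσ0 : 0 < σ := by linarith
  have hR := rarefactionExcess_nonneg hu.le
  have hσ2 : 0 ≤ σ ^ 2 - (u ^ 6 - u) ^ 2 := by nlinarith
  have hy : u ^ 6 - u ≤ 5 / 7 * (u ^ 7 - 1) := by
    obtain ⟨t, ht, rfl⟩ : ∃ t : ℝ, 0 ≤ t ∧ u = 1 + t := ⟨u - 1, by linarith, by ring⟩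
    rw [← sub_nonneg]; ring_nf; positivity
  have he : (u ^ 6 - u) ^ 2 ≤ u ^ 7 * (u ^ 5 - 1) - 5 / 7 * (u ^ 7 - 1) := by
    obtain ⟨t, ht, rfl⟩ : ∃ t : ℝ, 0 ≤ t ∧ u = 1 + t := ⟨u - 1, by linarith, by ring⟩
    rw [← sub_nonneg]; ring_nf; positivity
  have e : dualBound (σ * u ^ 5 / (u ^ 5 - 1)) (1 / u ^ 5) (u ^ 7) k
      = (σ ^ 2 - (u ^ 6 - u) ^ 2) / σ * ((5 / 7 * (u ^ 7 - 1)) ^ 2 / (2 * u ^ 7 * (u ^ 5 - 1)) + k)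
        + σ / (u ^ 6 - u) * rarefactionExcess u
        + (u ^ 5 - 1) / u ^ 5 * k / σ * (u ^ 7 * (u ^ 5 - 1) - 5 / 7 * (u ^ 7 - 1) - k / 2) := by
    have hz' : u ^ 6 - u = u * (u ^ 5 - 1) := by ring
    rw [hz']
    unfold dualBound bregman pdef rarefactionExcess
    have := hn.ne'
    field_simp
    ring
  rw [e]
  have h1 : (u ^ 5 - 1) / (2 * u ^ 5) ≤ (5 / 7 * (u ^ 7 - 1)) ^ 2 / (2 * u ^ 7 * (u ^ 5 - 1)) := by
    rw [div_le_div_iff₀ (by positivity) (by positivity)]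
    have h3 : (u ^ 6 - u) ^ 2 ≤ (5 / 7 * (u ^ 7 - 1)) ^ 2 := by gcongr
    have h4 := mul_le_mul_of_nonneg_right h3 (show 0 ≤ 2 * u ^ 5 by positivity)
    refine le_trans (le_of_eq ?_) h4
    ring
  have h2 : rarefactionExcess u ≤ σ / (u ^ 6 - u) * rarefactionExcess u := by
    apply le_mul_of_one_le_left hR
    rwa [one_le_div hz]
  have h3 : -((u ^ 5 - 1) / u ^ 5 * k / σ * (σ ^ 2 - (u ^ 6 - u) ^ 2)) ≤
      (u ^ 5 - 1) / u ^ 5 * k / σ * (u ^ 7 * (u ^ 5 - 1) - 5 / 7 * (u ^ 7 - 1) - k / 2) := by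
    rw [← mul_neg]
    apply mul_le_mul_of_nonneg_left (by linarith) (by positivity)
  have h4 : (σ ^ 2 - (u ^ 6 - u) ^ 2) / σ * ((u ^ 5 - 1) / (2 * u ^ 5) + k) ≤
      (σ ^ 2 - (u ^ 6 - u) ^ 2) / σ * ((5 / 7 * (u ^ 7 - 1)) ^ 2 / (2 * u ^ 7 * (u ^ 5 - 1)) + k) := by
    apply mul_le_mul_of_nonneg_left (by linarith) (by positivity)
  have h5 : (σ ^ 2 - (u ^ 6 - u) ^ 2) / σ * ((u ^ 5 - 1) / (2 * u ^ 5) + k / u ^ 5)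
      = (σ ^ 2 - (u ^ 6 - u) ^ 2) / σ * ((u ^ 5 - 1) / (2 * u ^ 5) + k) - ((u ^ 5 - 1) / u ^ 5 * k / σ * (σ ^ 2 - (u ^ 6 - u) ^ 2)) := by
    field_simp
    ring
  linarith

/-! ### Balance of loss and gain -/

theorem slope_le_half {al z : ℝ} (hal0 : 0 < al) (hal1 : al ≤ 1) (hz0 : 0 ≤ z) (hz1 : z ≤ al) :
    3 / 16 * (2 * (al ^ 2 + z * al + z ^ 2) - (z + al) * (z ^ 2 + al ^ 2))
      ≤ (1 + z / al) * (1 / 2) := by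
  have h1 : 0 ≤ z / al := by positivity
  have h2 : 2 * (al ^ 2 + z * al + z ^ 2) - (z + al) * (z ^ 2 + al ^ 2) ≤ 8 / 3 := by
    obtain ⟨w, rfl⟩ : ∃ w, z = w * al := ⟨z / al, by field_simp⟩
    have hw0 : 0 ≤ w := nonneg_of_mul_nonneg_left hz0 hal0
    have hw1 : w ≤ 1 := by nlinarith
    have e : 2 * (al ^ 2 + w * al * al + (w * al) ^ 2) - (w * al + al) * ((w * al) ^ 2 + al ^ 2)
        = al ^ 2 * (2 * (1 + w + w ^ 2) - al * ((1 + w) * (1 + w ^ 2))) := by ring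
    rw [e]
    have h3 : 6 * al ^ 2 - 4 * al ^ 3 ≤ 2 := by nlinarith [mul_nonneg hal0.le (sq_nonneg (al - 1))]
    have h4 : 2 * (1 + w + w ^ 2) - (1 + w) * (1 + w ^ 2) ≤ 2 := by
      nlinarith [mul_nonneg (sub_nonneg.2 hw1) (show 0 ≤ 1 - w ^ 2 by nlinarith)]
    have h5 : 2 * (1 + w + w ^ 2) ≤ 6 := by nlinarith
    have h6 := mul_le_mul_of_nonneg_left h4 (show 0 ≤ al ^ 3 by positivity)
    have h7 := mul_le_mul_of_nonneg_left h5
      (show 0 ≤ al ^ 2 * (1 - al) from mul_nonneg (by positivity) (by linarith))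
    linarith
  linarith

theorem slope_le_of_large {al z : ℝ} (hal0 : 0 < al) (hal1 : al ≤ 1) (hz0 : 0 ≤ z)
    (hz1 : z ≤ al) :
    3 / 16 * (2 * (al ^ 2 + z * al + z ^ 2) - (z + al) * (z ^ 2 + al ^ 2)) * (al * (1 + z))
      ≤ (al + z) * (z / 2 + al * (2 / 5 * al)) := by
  obtain ⟨w, rfl⟩ : ∃ w, z = w * al := ⟨z / al, by field_simp⟩
  have hw0 : 0 ≤ w := nonneg_of_mul_nonneg_left hz0 hal0
  have hw1 : w ≤ 1 := by nlinarith
  have e : (al + w * al) * (w * al / 2 + al * (2 / 5 * al))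
      - 3 / 16 * (2 * (al ^ 2 + w * al * al + (w * al) ^ 2)
        - (w * al + al) * ((w * al) ^ 2 + al ^ 2)) * (al * (1 + w * al))
      = al ^ 2 * (w * (1 + w) / 2 + al * (1 + w) * (2 / 5) - 3 / 8 * al * (1 + w + w ^ 2)
        - 3 / 16 * al ^ 2 * (w + w ^ 2 + w ^ 3) + 3 / 16 * al ^ 2
        + 3 / 16 * al ^ 3 * (w * (1 + w) * (1 + w ^ 2))) := by ring
  rw [← sub_nonneg, e]
  apply mul_nonneg (by positivity)
  have h1 : al * w ^ 2 ≤ w ^ 2 := by nlinarith [sq_nonneg w]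
  have h2 : al ^ 2 ≤ 1 := pow_le_one₀ hal0.le hal1
  have h3 : w ^ 3 ≤ w ^ 2 := by nlinarith [sq_nonneg w]
  have h4 : w ^ 2 ≤ w := by nlinarith
  have h5 : al ^ 2 * (w + w ^ 2 + w ^ 3) ≤ w + w ^ 2 + w ^ 3 := by
    apply mul_le_of_le_one_left (by positivity) h2
  have h6 : 0 ≤ al ^ 3 * (w * (1 + w) * (1 + w ^ 2)) := by positivity
  have h7 : 0 ≤ al * w := by positivity
  nlinarith [sq_nonneg al]

/-- Scaling z = wα and X = sα leaves polynomials with w ∈ [0, 1] and s ∈ [0, 2/5]. -/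
theorem small_jump_bound {al z X : ℝ} (hal0 : 0 < al) (hal1 : al ≤ 1) (hz0 : 0 ≤ z)
    (hz1 : z ≤ al) (hX0 : 0 ≤ X) (hX1 : X ≤ 2 / 5 * al) :
    9 / 5 * (1 - al) * al * X ^ 2
      ≤ (al - z) * (1 + z / al) * ((z / 2 + al * X) / (1 + z)) + 3 / 16 * z ^ 3 * (2 - z) := by
  obtain ⟨w, rfl⟩ : ∃ w, z = w * al := ⟨z / al, by field_simp⟩
  obtain ⟨s, rfl⟩ : ∃ s, X = s * al := ⟨X / al, by field_simp⟩
  have hw0 : 0 ≤ w := nonneg_of_mul_nonneg_left hz0 hal0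
  have hw1 : w ≤ 1 := by nlinarith
  have hs0 : 0 ≤ s := nonneg_of_mul_nonneg_left hX0 hal0
  have hs1 : s ≤ 2 / 5 := by nlinarith
  have e : (al - w * al) * (1 + w * al / al) * ((w * al / 2 + al * (s * al)) / (1 + w * al))
      + 3 / 16 * (w * al) ^ 3 * (2 - w * al) - 9 / 5 * (1 - al) * al * (s * al) ^ 2
      = al ^ 2 * ((1 - w ^ 2) * w / 2 + al * ((1 - w ^ 2) * s + 3 / 8 * w ^ 3
          + 3 / 16 * w ^ 4 * al * (1 - w * al)
          - 9 / 5 * s ^ 2 * ((1 - al) * (1 + w * al)))) / (1 + w * al) := by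
    field_simp
    ring
  rw [← sub_nonneg, e]
  have hwal : w * al ≤ 1 := mul_le_one₀ hw1 hal0.le hal1
  have h1 : (1 - al) * (1 + w * al) ≤ 1 := by nlinarith [mul_nonneg hw0 hal0.le]
  have h2 : s ^ 2 * ((1 - al) * (1 + w * al)) ≤ s ^ 2 := mul_le_of_le_one_right (sq_nonneg s) h1
  have h3 : 0 ≤ w ^ 4 * al * (1 - w * al) := mul_nonneg (by positivity) (by linarith)
  have h4 : 0 ≤ (1 - w ^ 2) * w / 2 := by
    have : 0 ≤ 1 - w ^ 2 := by nlinarith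
    positivity
  have h5 : 0 ≤ 14 / 125 - 2 / 5 * w ^ 2 + 3 / 8 * w ^ 3 := by
    nlinarith [mul_nonneg hw0 (sq_nonneg (w - 7 / 10)), sq_nonneg (w - 7 / 10)]
  have h6 : 0 ≤ (1 - w ^ 2) * s + 3 / 8 * w ^ 3 - 9 / 5 * s ^ 2 := by
    -- A concave quadratic in s, written as its chord over [0, 2/5] plus a nonnegative remainder.
    have h7 : (1 - w ^ 2) * s + 3 / 8 * w ^ 3 - 9 / 5 * s ^ 2
      = 5 / 2 * s * (14 / 125 - 2 / 5 * w ^ 2 + 3 / 8 * w ^ 3)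
        + 5 / 2 * (2 / 5 - s) * (3 / 8 * w ^ 3) + 9 / 5 * (s * (2 / 5 - s)) := by ring
    rw [h7]
    have : 0 ≤ 2 / 5 - s := by linarith
    positivity
  apply div_nonneg _ (by positivity)
  apply mul_nonneg (by positivity)
  have := mul_nonneg hal0.le (show 0 ≤ (1 - w ^ 2) * s + 3 / 8 * w ^ 3
          + 3 / 16 * w ^ 4 * al * (1 - w * al)
          - 9 / 5 * s ^ 2 * ((1 - al) * (1 + w * al)) by linarith)
  linarith

set_option maxHeartbeats 800000 in
/-- An expanded left state of mass flux less than `1` and a compressed right state. -/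
theorem dualBound_add_nonneg {al b u v pl pr : ℝ} (hal0 : 0 < al) (hal1 : al < 1) (hb : 0 < b)
    (hv : 1 ≤ v) (hpl1 : pl ≤ 1) (hplv : 1 ≤ pl * v ^ 7)
    (hu : 1 < u) (hpr : u ^ 7 ≤ pr) (hbpr : pr * u ^ 5 ≤ b ^ 2)
    (hS : u ≤ 1 - al + b * (1 - 1 / u ^ 5)) :
    ∃ k, 0 ≤ dualBound (1 - al) (v ^ 5) pl k + dualBound b (1 / u ^ 5) pr k := by
  have hu0 : 0 < u := by linarith
  have hn : 0 < u ^ 5 - 1 := by linarith [one_lt_pow₀ hu (n := 5) (by norm_num)]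
  have hz' : u ^ 6 - u = u * (u ^ 5 - 1) := by ring
  have hz : 0 < u ^ 6 - u := by rw [hz']; positivity
  have hbτ : pr ≤ b ^ 2 * (1 / u ^ 5) := by
    rw [mul_one_div, le_div_iff₀ (by positivity)]; exact hbpr
  have hu7 : 1 ≤ u ^ 7 := one_le_pow₀ hu.le
  have hX0 : 0 ≤ pdef pl := by unfold pdef; linarith
  have hpl0 : 0 < pl := by
    by_contra hc
    push Not at hc
    have : 0 ≤ v ^ 7 := by positivity
    have := mul_nonneg (neg_nonneg.2 hc) this
    linarith
  have hX1 : pdef pl ≤ 5 / 7 := by unfold pdef; linarith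
  rcases le_total (2 * al) (pdef pl) with hX | hX
  · refine ⟨0, add_nonneg (dualBound_left_zero hal1 hv hpl1 hplv hX) ?_⟩
    have h1 : (1 : ℝ) / u ^ 5 = (1 / u) ^ 5 := by rw [one_div_pow]
    rw [h1] at hbτ ⊢
    refine dualBound_zero_of_one_le hb (by positivity) (hu7.trans hpr) ?_ hbτ
    rw [one_div_pow, mul_one_div, le_div_iff₀ (by positivity)]
    linarith
  set X := pdef pl with hXdef
  refine ⟨al * X, ?_⟩
  have hk0 : 0 ≤ al * X := by positivity
  have hk1 : al * X ≤ 1 := mul_le_one₀ hal1.le hX0 (by linarith)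
  have hk2 : al * X ≤ 2 * al ^ 2 := by
    have := mul_le_mul_of_nonneg_left hX hal0.le
    linarith
  have hbr : 0 ≤ bregman (1 / u ^ 5) (u ^ 7) - al * X * (1 / u ^ 5 - 1) := by
    have h1 : 0 ≤ al * X * (1 - 1 / u ^ 5) := by
      apply mul_nonneg hk0
      rw [sub_nonneg, div_le_one (by positivity)]
      linarith
    have h2 : 0 ≤ bregman (1 / u ^ 5) (u ^ 7) := by
      have : bregman (1 / u ^ 5) (u ^ 7) = (5 * u ^ 7 - 7 * u ^ 5 + 2) * (5 / 14) / u ^ 5 := by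
        unfold bregman; field_simp; ring
      rw [this]
      apply div_nonneg _ (by positivity)
      obtain ⟨t, ht, rfl⟩ : ∃ t : ℝ, 0 ≤ t ∧ u = 1 + t := ⟨u - 1, by linarith, by ring⟩
      ring_nf; positivity
    linarith
  have hb6 : u ^ 6 ≤ b := by
    apply le_of_sq_le_sq _ hb.le
    calc (u ^ 6) ^ 2 = u ^ 7 * u ^ 5 := by ring
      _ ≤ pr * u ^ 5 := by gcongr
      _ ≤ b ^ 2 := hbpr
  have hmono : ∀ σ, 0 < σ → σ * u ^ 5 / (u ^ 5 - 1) ≤ b →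
      dualBound (σ * u ^ 5 / (u ^ 5 - 1)) (1 / u ^ 5) (u ^ 7) (al * X)
        ≤ dualBound b (1 / u ^ 5) pr (al * X) := fun σ hσ h =>
    (dualBound_mono_mass (by positivity) h hbr).trans
      (dualBound_mono_pressure hb hk1 hu7 hpr hbτ)
  have hL := dualBound_left_ge hal0.le hal1 hv hpl1 hplv
  set z := u ^ 6 - 2 * u + 1 with hzdef
  have hz0 : 0 < z := by
    obtain ⟨t, ht, rfl⟩ : ∃ t : ℝ, 0 < t ∧ u = 1 + t := ⟨u - 1, by linarith, by ring⟩
    rw [hzdef]; ring_nf; positivity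
  -- The mass flux b has two lower bounds: u⁶ from `hb6`, and the one with σ = α + u − 1 from `hS`.
  -- The second is the stronger exactly when z ≤ α.
  rcases le_total al z with hz1 | hz1
  · have h1 := dualBound_right_ge (σ := u ^ 6 - u) hu le_rfl hk0 (by
      have : al ^ 2 ≤ (u ^ 6 - u) ^ 2 := pow_le_pow_left₀ hal0.le (by linarith) 2
      linarith)
    have h2 := hmono (u ^ 6 - u) hz (by
      rw [div_le_iff₀ hn]
      refine le_trans (le_of_eq ?_) (mul_le_mul_of_nonneg_right hb6 hn.le)
      ring)
    have h3 : 3 / 16 * al ^ 3 * (2 - al) ≤ rarefactionExcess u := by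
      rcases le_total (u ^ 5) 2 with h | h
      · have : z ≤ 1 := by
          have e : z - 1 = u * (u ^ 5 - 2) := by rw [hzdef]; ring
          have := mul_nonneg hu0.le (sub_nonneg.2 h)
          linarith
        have := pow_mul_two_sub_mono hal0.le hz1 this
        have := rarefactionExcess_ge hu.le h
        rw [← hzdef] at this
        linarith
      · have h4 := pow_mul_two_sub_mono hal0.le hal1.le le_rfl
        have h5 := rarefactionExcess_ge_of_two_le hu.le h
        linarith
    rw [sub_self, zero_div, zero_mul, zero_add] at h1
    linarith
  · have hu2 : u ^ 5 < 2 := by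
      have : z - 1 = u * (u ^ 5 - 2) := by rw [hzdef]; ring
      by_contra hc
      push Not at hc
      have := mul_nonneg hu0.le (sub_nonneg.2 hc)
      linarith
    have hR0 := rarefactionExcess_ge hu.le hu2.le
    rw [← hzdef] at hR0
    set σ := al + u - 1 with hσ
    have hσ0 : 0 < σ := by linarith
    have hσz : u ^ 6 - u ≤ σ := by linarith
    have h1 := dualBound_right_ge (σ := σ) hu hσz hk0 (by
      have : al ^ 2 ≤ σ ^ 2 := pow_le_pow_left₀ hal0.le (by linarith) 2
      linarith)
    have h2 := hmono σ hσ0 (by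
      rw [div_le_iff₀ hn]
      have : b * (1 - 1 / u ^ 5) = b * (u ^ 5 - 1) / u ^ 5 := by field_simp
      rw [this] at hS
      have h3 : σ ≤ b * (u ^ 5 - 1) / u ^ 5 := by linarith
      rwa [le_div_iff₀ (by positivity)] at h3)
    -- Since σ − (u⁶ − u) = α − z, the gain has the factor α − z, as does the difference of the loss
    -- function between α and z. Where the uniform loss bound is used, only a slope inequality
    -- remains.
    have hfac : (al - z) * (1 + z / al) ≤ (σ ^ 2 - (u ^ 6 - u) ^ 2) / σ := by
      have e1 : (σ ^ 2 - (u ^ 6 - u) ^ 2) / σ = (al - z) * (1 + (u ^ 6 - u) / σ) := by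
        field_simp
        rw [hσ, hzdef]; ring
      rw [e1]
      apply mul_le_mul_of_nonneg_left _ (by linarith)
      have : z / al ≤ (u ^ 6 - u) / σ := by
        rw [div_le_div_iff₀ hal0 hσ0]
        have : (u ^ 6 - u) * al - z * σ = (u - 1) * (al - z) := by rw [hσ, hzdef]; ring
        have := mul_nonneg (sub_nonneg.2 hu.le) (sub_nonneg.2 hz1)
        linarith
      linarith
    have hfac0 : 0 ≤ (al - z) * (1 + z / al) := mul_nonneg (by linarith) (by positivity)
    have hη : z / (1 + z) ≤ (u ^ 5 - 1) / u ^ 5 := by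
      rw [div_le_div_iff₀ (by positivity) (by positivity)]
      have : (u ^ 5 - 1) * (1 + z) - z * u ^ 5 = (u - 1) * (2 - u ^ 5) := by rw [hzdef]; ring
      have := mul_nonneg (sub_nonneg.2 hu.le) (sub_nonneg.2 hu2.le)
      linarith
    -- A convex combination of αX and 1/2 with weight 1 − u⁻⁵ on 1/2: at least 1/2 if αX ≥ 1/2,
    -- otherwise increasing in the weight.
    have hconv : ((u ^ 5 - 1) / (2 * u ^ 5) + al * X / u ^ 5)
        = al * X + (1 / 2 - al * X) * ((u ^ 5 - 1) / u ^ 5) := by field_simp; ring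
    have hR : ∀ m, m ≤ ((u ^ 5 - 1) / (2 * u ^ 5) + al * X / u ^ 5) → 0 ≤ m →
        (al - z) * (1 + z / al) * m + 3 / 16 * z ^ 3 * (2 - z) ≤
          dualBound b (1 / u ^ 5) pr (al * X) := by
      intro m hm hm0
      have : (al - z) * (1 + z / al) * m ≤ (σ ^ 2 - (u ^ 6 - u) ^ 2) / σ * ((u ^ 5 - 1) / (2 * u ^ 5) + al * X / u ^ 5) := by
        apply mul_le_mul hfac hm hm0 (hfac0.trans hfac)
      linarith
    have hza : z / al ≤ 1 := by rw [div_le_one hal0]; exact hz1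
    have hza0 : 0 ≤ z / al := by positivity
    have hg : al ^ 3 * (2 - al) - z ^ 3 * (2 - z) =
      (al - z) * (2 * (al ^ 2 + z * al + z ^ 2) - (z + al) * (z ^ 2 + al ^ 2)) := by ring
    rcases le_total (1 / 2) (al * X) with hbig | hsm
    · have hm : 1 / 2 ≤ ((u ^ 5 - 1) / (2 * u ^ 5) + al * X / u ^ 5) := by
        rw [hconv]
        have : (u ^ 5 - 1) / u ^ 5 ≤ 1 := by rw [div_le_one (by positivity)]; linarith
        have := mul_nonneg (sub_nonneg.2 hbig) (sub_nonneg.2 this)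
        linarith
      have h3 := hR _ hm (by norm_num)
      have h4 : (3 / 16) * (2 * (al ^ 2 + z * al + z ^ 2) - (z + al) * (z ^ 2 + al ^ 2)) ≤ (1 + z / al) * (1 / 2) :=
        slope_le_half hal0 hal1.le hz0.le hz1
      have h5 := mul_le_mul_of_nonneg_left h4 (sub_nonneg.2 hz1)
      linarith
    have hm : (z / 2 + al * X) / (1 + z) ≤ ((u ^ 5 - 1) / (2 * u ^ 5) + al * X / u ^ 5) := by
      rw [hconv]
      have : (z / 2 + al * X) / (1 + z) = al * X + (1 / 2 - al * X) * (z / (1 + z)) := by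
        field_simp; ring
      rw [this]
      have := mul_le_mul_of_nonneg_left hη (sub_nonneg.2 hsm)
      linarith
    have h3 := hR _ hm (by positivity)
    rcases le_total (2 / 5 * al) X with hX2 | hX2
    · have h4 : (3 / 16) * (2 * (al ^ 2 + z * al + z ^ 2) - (z + al) * (z ^ 2 + al ^ 2)) ≤ (1 + z / al) * ((z / 2 + al * X) / (1 + z)) := by
        have h6 : (1 + z / al) * ((z / 2 + al * X) / (1 + z)) = (al + z) * (z / 2 + al * X) / (al * (1 + z)) := by
          field_simp
        rw [h6, le_div_iff₀ (by positivity)]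
        have h7 : (al + z) * (z / 2 + al * (2 / 5 * al)) ≤ (al + z) * (z / 2 + al * X) := by gcongr
        exact (slope_le_of_large hal0 hal1.le hz0.le hz1).trans h7
      have h5 := mul_le_mul_of_nonneg_left h4 (sub_nonneg.2 hz1)
      linarith
    · have hL2 := dualBound_left_ge_of_small hal0.le hal1 hv hpl1 hplv (by linarith)
      rw [← hXdef] at hL2
      have h4 : 9 / 5 * (1 - al) * al * X ^ 2 ≤ (al - z) * (1 + z / al) * ((z / 2 + al * X) / (1 + z)) + 3 / 16 * z ^ 3 * (2 - z) :=
        small_jump_bound hal0 hal1.le hz0.le hz1 hX0 hX2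
      linarith

/-! ### Nonnegativity of the pair form -/

theorem pairForm_nonneg_of_dual {a b τl τr pl pr : ℝ} (ha : 0 < a) (hb : 0 < b)
    (h : ∃ k, 0 ≤ dualBound a τl pl k + dualBound b τr pr k) :
    0 ≤ pairForm a b τl τr pl pr := by
  obtain ⟨k, hk⟩ := h
  exact (mul_nonneg (by linarith) hk).trans (pairForm_ge ha hb k)

theorem one_le_of_pressure {v p : ℝ} (hv : 0 < v) (hp : p ≤ 1) (hpv : 1 ≤ p * v ^ 7) : 1 ≤ v := by
  by_contra hc
  push Not at hc
  have h1 : v ^ 7 < 1 := pow_lt_one₀ hv.le hc (by norm_num)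
  have h2 : 0 < v ^ 7 := by positivity
  nlinarith

theorem pairForm_nonneg_of_light {a b v w pl pr : ℝ} (ha : 0 < a) (hb : 0 < b) (hv : 0 < v)
    (hw : 0 < w) (hplv : 1 ≤ pl * v ^ 7) (hprw : 1 ≤ pr * w ^ 7) (hbw : pr ≤ b ^ 2 * w ^ 5)
    (hS0 : 0 < a + b * (1 - w ^ 5)) (hS : pr * w ^ 5 ≤ (a + b * (1 - w ^ 5)) ^ 2)
    (hT0 : 0 < b + a * (1 - v ^ 5)) (hT : pl * v ^ 5 ≤ (b + a * (1 - v ^ 5)) ^ 2)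
    (hpl : pl ≤ 1) (ha1 : a < 1) : 0 ≤ pairForm a b (v ^ 5) (w ^ 5) pl pr := by
  have hv1 := one_le_of_pressure hv hpl hplv
  rcases le_or_gt 1 w with hw1 | hw1
  · linarith [one_le_of_expanded ha hb hv1 hw1 hplv hprw hbw hS0 hS hT0 hT]
  · obtain ⟨u, hu, rfl⟩ : ∃ u : ℝ, 1 < u ∧ w = 1 / u :=
      ⟨1 / w, by rwa [one_lt_div hw], by rw [one_div_one_div]⟩
    have hu0 : 0 < u := by linarith
    apply pairForm_nonneg_of_dual ha hb
    rw [one_div_pow] at hprw hbw hS0 hS ⊢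
    rw [mul_one_div, le_div_iff₀ (by positivity)] at hprw hbw
    have := dualBound_add_nonneg (al := 1 - a) (by linarith) (by linarith) hb hv1 hpl hplv hu
      (by linarith) hbw (by
        rw [sub_sub_cancel]
        apply le_of_sq_le_sq _ hS0.le
        refine le_trans ?_ hS
        rw [mul_one_div, le_div_iff₀ (by positivity)]
        calc u ^ 2 * u ^ 5 = 1 * u ^ 7 := by ring
          _ ≤ pr := hprw)
    rwa [sub_sub_cancel] at this

theorem pairForm_nonneg {a b v w pl pr : ℝ} (ha : 0 < a) (hb : 0 < b) (hv : 0 < v) (hw : 0 < w)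
    (hplv : 1 ≤ pl * v ^ 7) (hprw : 1 ≤ pr * w ^ 7)
    (hav : pl ≤ a ^ 2 * v ^ 5) (hbw : pr ≤ b ^ 2 * w ^ 5)
    (hS0 : 0 < a + b * (1 - w ^ 5)) (hS : pr * w ^ 5 ≤ (a + b * (1 - w ^ 5)) ^ 2)
    (hT0 : 0 < b + a * (1 - v ^ 5)) (hT : pl * v ^ 5 ≤ (b + a * (1 - v ^ 5)) ^ 2) :
    0 ≤ pairForm a b (v ^ 5) (w ^ 5) pl pr := by
  by_cases hl : pl ≤ 1 ∧ a < 1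
  · exact pairForm_nonneg_of_light ha hb hv hw hplv hprw hbw hS0 hS hT0 hT hl.1 hl.2
  by_cases hr : pr ≤ 1 ∧ b < 1
  · rw [pairForm_comm]
    exact pairForm_nonneg_of_light hb ha hw hv hprw hplv hav hT0 hT hS0 hS hr.1 hr.2
  have good : ∀ {a v p : ℝ}, 0 < a → 0 < v → 1 ≤ p * v ^ 7 → p ≤ a ^ 2 * v ^ 5 →
      ¬(p ≤ 1 ∧ a < 1) → 0 ≤ dualBound a (v ^ 5) p 0 := by
    intro a v p ha hv hpv hav hn
    rcases le_total 1 p with h | h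
    · exact dualBound_zero_of_one_le ha hv h hpv hav
    · exact dualBound_zero_of_le_one (not_lt.1 fun hc => hn ⟨h, hc⟩)
        (one_le_of_pressure hv h hpv) h hpv
  exact pairForm_nonneg_of_dual ha hb
    ⟨0, add_nonneg (good ha hv hplv hav hl) (good hb hw hprw hbw hr)⟩

/-! ### Return to physical variables -/

/-- `hrdef` makes the velocity jump proportional to the mismatch of the scaled volume changes
(`hd`), and Z² = γPr gives all terms the common factor (γP)². -/
theorem energy_sub_eq_pairForm {lam r₁ r₂ u₁ u₂ p₁ p₂ r P Z : ℝ} (hr₁ : r₁ ≠ 0) (hr₂ : r₂ ≠ 0)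
    (hr : r ≠ 0) (hP : P ≠ 0) (hZ : Z ^ 2 = 7 / 5 * P * r)
    (hrdef : 2 * lam * r = (lam + u₁) * r₁ + (lam - u₂) * r₂) :
    (2 * lam * r) * ((lam + u₁) * (5 / 2 * p₁ + r₁ * u₁ ^ 2 / 2) + p₁ * u₁
          + ((lam - u₂) * (5 / 2 * p₂ + r₂ * u₂ ^ 2 / 2) - p₂ * u₂))
      - ((2 * lam * r) * (2 * lam * (5 / 2 * P))
        + ((lam + u₁) * (r₁ * u₁) + p₁ + ((lam - u₂) * (r₂ * u₂) - p₂)) ^ 2 / 2)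
      = (7 / 5 * P) ^ 2 * pairForm ((lam + u₁) * r₁ / Z) ((lam - u₂) * r₂ / Z) (r / r₁) (r / r₂)
          (p₁ / P) (p₂ / P) := by
  have hZ0 : Z ≠ 0 := by
    rintro rfl
    apply mul_ne_zero (mul_ne_zero (by norm_num : (7 / 5 : ℝ) ≠ 0) hP) hr
    rw [← hZ]; norm_num
  have hd : (lam - u₂) * r₂ / Z * (1 - r / r₂) - (lam + u₁) * r₁ / Z * (r / r₁ - 1)
      = (u₂ - u₁) * r / Z := by
    field_simp
    linear_combination -hrdef
  have hab : (lam + u₁) * r₁ / Z + (lam - u₂) * r₂ / Z = 2 * lam * r / Z := by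
    rw [hrdef]; ring
  have hL : 7 / 5 * P * ((lam + u₁) * r₁ * bregman (r / r₁) (p₁ / P))
      = 5 / 2 * (p₁ * r * (lam + u₁) - P * ((lam + u₁) * r₁))
        + P * ((lam + u₁) * r - (lam + u₁) * r₁) := by
    unfold bregman; field_simp; ring
  have hR : 7 / 5 * P * ((lam - u₂) * r₂ * bregman (r / r₂) (p₂ / P))
      = 5 / 2 * (p₂ * r * (lam - u₂) - P * ((lam - u₂) * r₂))
        + P * ((lam - u₂) * r - (lam - u₂) * r₂) := by
    unfold bregman; field_simp; ring
  have hp : ∀ p, 7 / 5 * P * pdef (p / P) = P - p := by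
    intro p; unfold pdef; field_simp
  have hs : 7 / 5 * P * r * (Z⁻¹) ^ 2 = 1 := by rw [← hZ]; field_simp
  have hpair : (7 / 5 * P) ^ 2 * pairForm ((lam + u₁) * r₁ / Z) ((lam - u₂) * r₂ / Z)
      (r / r₁) (r / r₂) (p₁ / P) (p₂ / P)
      = (7 / 5 * P * r * (Z⁻¹) ^ 2) * (2 * lam * (7 / 5 * P * ((lam + u₁) * r₁ *
          bregman (r / r₁) (p₁ / P)) + 7 / 5 * P * ((lam - u₂) * r₂ * bregman (r / r₂) (p₂ / P))))
        + (7 / 5 * P * r * (Z⁻¹) ^ 2) ^ 2 * ((lam + u₁) * r₁ * ((lam - u₂) * r₂)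
          * (u₂ - u₁) ^ 2 / 2)
        + (7 / 5 * P * r * (Z⁻¹) ^ 2) * ((u₂ - u₁) * ((lam - u₂) * r₂ * (7 / 5 * P * pdef (p₁ / P))
          + (lam + u₁) * r₁ * (7 / 5 * P * pdef (p₂ / P))))
        - (7 / 5 * P * pdef (p₁ / P) - 7 / 5 * P * pdef (p₂ / P)) ^ 2 / 2 := by
    unfold pairForm
    rw [hd, hab]
    ring
  rw [hpair, hs, hL, hR, hp, hp]
  linear_combination (((lam + u₁) * r₁ * u₁ ^ 2 + (lam - u₂) * r₂ * u₂ ^ 2) / 2 + p₁ * u₁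
    - p₂ * u₂ - 5 * lam * P - (2 * lam - u₂ + u₁) * P) * hrdef

/-- The Lax–Friedrichs mixture of two states with densities `r₁, r₂`, velocities `u₁, u₂`, pressures
`p₁, p₂` and sound speeds `c₁, c₂` has energy at least that of a gas of pressure `P` at the same
density `r` and momentum, if `P` lies below the isentropes through both states at density `r`. -/
theorem energy_inequality {lam r₁ r₂ u₁ u₂ p₁ p₂ c₁ c₂ r P : ℝ} (hr₁ : 0 < r₁) (hr₂ : 0 < r₂)
    (hc₁ : 0 < c₁) (hc₂ : 0 < c₂)
    (hcc₁ : c₁ ^ 2 * r₁ = 7 / 5 * p₁) (hcc₂ : c₂ ^ 2 * r₂ = 7 / 5 * p₂)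
    (h₁ : |u₁| + c₁ ≤ lam) (h₂ : |u₂| + c₂ ≤ lam) (hr : 0 < r) (hP : 0 < P)
    (hrdef : 2 * lam * r = (lam + u₁) * r₁ + (lam - u₂) * r₂)
    {v w : ℝ} (hv : 0 < v) (hw : 0 < w) (hvr : r = v ^ 5 * r₁) (hwr : r = w ^ 5 * r₂)
    (hPv : P ≤ p₁ * v ^ 7) (hPw : P ≤ p₂ * w ^ 7) :
    (2 * lam * r) * (2 * lam * (5 / 2 * P))
        + ((lam + u₁) * (r₁ * u₁) + p₁ + ((lam - u₂) * (r₂ * u₂) - p₂)) ^ 2 / 2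
      ≤ (2 * lam * r) * ((lam + u₁) * (5 / 2 * p₁ + r₁ * u₁ ^ 2 / 2) + p₁ * u₁
          + ((lam - u₂) * (5 / 2 * p₂ + r₂ * u₂ ^ 2 / 2) - p₂ * u₂)) := by
  have hu₁ := abs_le.1 (show |u₁| ≤ lam - c₁ by linarith)
  have hu₂ := abs_le.1 (show |u₂| ≤ lam - c₂ by linarith)
  obtain ⟨Z, hZ, hZZ⟩ : ∃ Z : ℝ, 0 < Z ∧ Z ^ 2 = 7 / 5 * P * r :=
    ⟨Real.sqrt (7 / 5 * P * r), Real.sqrt_pos.2 (by positivity), Real.sq_sqrt (by positivity)⟩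
  have hA : 0 < lam + u₁ := by linarith
  have hB : 0 < lam - u₂ := by linarith
  have hsq : ∀ {c x ρ p : ℝ}, 0 < c → 0 < ρ → c ≤ x → c ^ 2 * ρ = 7 / 5 * p → 7 / 5 * p ≤ x ^ 2 * ρ := by
    intro c x ρ p hc hρ hx he
    rw [← he]
    gcongr
  have q1 := hsq hc₁ hr₁ (show c₁ ≤ lam + u₁ by linarith) hcc₁
  have q2 := hsq hc₁ hr₁ (show c₁ ≤ lam - u₁ by linarith) hcc₁
  have q3 := hsq hc₂ hr₂ (show c₂ ≤ lam - u₂ by linarith) hcc₂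
  have q4 := hsq hc₂ hr₂ (show c₂ ≤ lam + u₂ by linarith) hcc₂
  have eS : (lam + u₁) * r₁ / Z + (lam - u₂) * r₂ / Z * (1 - w ^ 5) = (lam + u₂) * r / Z := by
    field_simp
    linear_combination hrdef * (-1) + (lam - u₂) * hwr
  have eT : (lam - u₂) * r₂ / Z + (lam + u₁) * r₁ / Z * (1 - v ^ 5) = (lam - u₁) * r / Z := by
    field_simp
    linear_combination hrdef * (-1) + (lam + u₁) * hvr
  have main := pairForm_nonneg (a := (lam + u₁) * r₁ / Z) (b := (lam - u₂) * r₂ / Z)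
    (v := v) (w := w) (pl := p₁ / P) (pr := p₂ / P) (by positivity) (by positivity) hv hw
    (by rw [div_mul_eq_mul_div, le_div_iff₀ hP]; linarith)
    (by rw [div_mul_eq_mul_div, le_div_iff₀ hP]; linarith)
    (by
      rw [div_pow, hZZ, div_mul_eq_mul_div, div_le_div_iff₀ hP (by positivity)]
      have : ((lam + u₁) * r₁) ^ 2 * v ^ 5 * P = (lam + u₁) ^ 2 * r₁ * (P * r) := by rw [hvr]; ring
      rw [this]
      have := mul_le_mul_of_nonneg_right q1 (show 0 ≤ P * r by positivity)
      linarith)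
    (by
      rw [div_pow, hZZ, div_mul_eq_mul_div, div_le_div_iff₀ hP (by positivity)]
      have : ((lam - u₂) * r₂) ^ 2 * w ^ 5 * P = (lam - u₂) ^ 2 * r₂ * (P * r) := by rw [hwr]; ring
      rw [this]
      have := mul_le_mul_of_nonneg_right q3 (show 0 ≤ P * r by positivity)
      linarith)
    (by rw [eS]; have : 0 < lam + u₂ := by linarith
        positivity)
    (by
      rw [eS, div_pow, hZZ, div_mul_eq_mul_div, div_le_div_iff₀ hP (by positivity)]
      have : ((lam + u₂) * r) ^ 2 * P = (lam + u₂) ^ 2 * r₂ * (P * r * w ^ 5) := by rw [hwr]; ring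
      rw [this]
      have := mul_le_mul_of_nonneg_right q4 (show 0 ≤ P * r * w ^ 5 by positivity)
      linarith)
    (by rw [eT]; have : 0 < lam - u₁ := by linarith
        positivity)
    (by
      rw [eT, div_pow, hZZ, div_mul_eq_mul_div, div_le_div_iff₀ hP (by positivity)]
      have : ((lam - u₁) * r) ^ 2 * P = (lam - u₁) ^ 2 * r₁ * (P * r * v ^ 5) := by rw [hvr]; ring
      rw [this]
      have := mul_le_mul_of_nonneg_right q2 (show 0 ≤ P * r * v ^ 5 by positivity)
      linarith)
  have hτ₁ : v ^ 5 = r / r₁ := by rw [hvr]; field_simp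
  have hτ₂ : w ^ 5 = r / r₂ := by rw [hwr]; field_simp
  rw [hτ₁, hτ₂] at main
  have id : (2 * lam * r) * ((lam + u₁) * (5 / 2 * p₁ + r₁ * u₁ ^ 2 / 2) + p₁ * u₁
          + ((lam - u₂) * (5 / 2 * p₂ + r₂ * u₂ ^ 2 / 2) - p₂ * u₂))
      - ((2 * lam * r) * (2 * lam * (5 / 2 * P))
        + ((lam + u₁) * (r₁ * u₁) + p₁ + ((lam - u₂) * (r₂ * u₂) - p₂)) ^ 2 / 2)
      = (7 / 5 * P) ^ 2 * pairForm ((lam + u₁) * r₁ / Z) ((lam - u₂) * r₂ / Z) (r / r₁) (r / r₂)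
          (p₁ / P) (p₂ / P) :=
    energy_sub_eq_pairForm hr₁.ne' hr₂.ne' hr.ne' hP.ne' hZZ hrdef
  have := mul_nonneg (show 0 ≤ (7 / 5 * P) ^ 2 by positivity) main
  linarith

/-! ### The convex invariant set and the intermediate state -/

/-- The states of positive density whose pressure is at least `C ρ ^ γ`. -/
def entropySet (C : ℝ) : Set State := {U | 0 < density U ∧ C * density U ^ gam ≤ pressure U}

theorem pressure_eq {U : State} (h : 0 < density U) :
    pressure U = 2 / 5 * (U 2 - U 1 ^ 2 / (2 * U 0)) := by
  have h0 : U 0 ≠ 0 := h.ne'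
  simp only [pressure, velocity, density, gam]
  field_simp
  ring

theorem sq_combo_div_le {a b x y m n : ℝ} (ha : 0 ≤ a) (hb : 0 ≤ b) (hx : 0 < x) (hy : 0 < y)
    (hxy : 0 < a * x + b * y) :
    (a * m + b * n) ^ 2 / (2 * (a * x + b * y)) ≤ a * (m ^ 2 / (2 * x)) + b * (n ^ 2 / (2 * y)) := by
  rw [div_le_iff₀ (by positivity), ← sub_nonneg]
  have : (a * (m ^ 2 / (2 * x)) + b * (n ^ 2 / (2 * y))) * (2 * (a * x + b * y))
      - (a * m + b * n) ^ 2 = a * b * (m * y - n * x) ^ 2 / (x * y) := by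
    field_simp
    ring
  rw [this]
  positivity

/-- ρ^γ is convex, and the pressure is concave because m²/(2ρ) is jointly convex in (ρ, m). -/
theorem convex_entropySet {C : ℝ} (hC : 0 ≤ C) : Convex ℝ (entropySet C) := by
  rintro U ⟨hU, hU'⟩ V ⟨hV, hV'⟩ a b ha hb hab
  have hd : density (a • U + b • V) = a * density U + b * density V := by simp [density]
  have hpos : 0 < a * density U + b * density V := by
    rcases ha.eq_or_lt with rfl | ha
    · have : b = 1 := by linarith
      subst this; simpa using hV
    · have := mul_pos ha hU
      have := mul_nonneg hb hV.le
      linarith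
  refine ⟨by rwa [hd], ?_⟩
  have h1 : density (a • U + b • V) ^ gam ≤ a * density U ^ gam + b * density V ^ gam := by
    rw [hd]
    exact (convexOn_rpow (p := gam) (by norm_num [gam])).2 hU.le hV.le ha hb hab
  have h2 : a * pressure U + b * pressure V ≤ pressure (a • U + b • V) := by
    rw [pressure_eq hU, pressure_eq hV, pressure_eq (by rwa [hd])]
    have := sq_combo_div_le (m := U 1) (n := V 1) ha hb hU hV hpos
    simp only [density, Pi.add_apply, Pi.smul_apply, smul_eq_mul] at this ⊢
    linarith
  calc C * density (a • U + b • V) ^ gam ≤ C * (a * density U ^ gam + b * density V ^ gam) := by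
        gcongr
    _ = a * (C * density U ^ gam) + b * (C * density V ^ gam) := by ring
    _ ≤ a * pressure U + b * pressure V := by gcongr
    _ ≤ _ := h2

theorem soundSpeed_pos {U : State} (h : Admissible U) : 0 < soundSpeed U := by
  obtain ⟨h1, h2⟩ := h
  unfold soundSpeed gam
  positivity

theorem soundSpeed_sq_mul {U : State} (h : Admissible U) :
    soundSpeed U ^ 2 * density U = 7 / 5 * pressure U := by
  obtain ⟨h1, h2⟩ := h
  unfold soundSpeed gam
  rw [Real.sq_sqrt (by positivity)]
  field_simp

/-- The expansion ratio from `ρ` to `r`, written as `v ^ 5`, and the pressure after the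
corresponding isentropic process. -/
theorem exists_expansion {C r ρ p : ℝ} (hr : 0 < r) (hρ : 0 < ρ) (hp : C * ρ ^ gam ≤ p) :
    ∃ v : ℝ, 0 < v ∧ r = v ^ 5 * ρ ∧ C * r ^ gam ≤ p * v ^ 7 := by
  have hq : 0 < r / ρ := by positivity
  have h5 : ((r / ρ) ^ (1 / 5 : ℝ)) ^ 5 = r / ρ := by
    rw [← Real.rpow_natCast, ← Real.rpow_mul hq.le]; norm_num
  have h7 : ((r / ρ) ^ (1 / 5 : ℝ)) ^ 7 = (r / ρ) ^ gam := by
    rw [← Real.rpow_natCast, ← Real.rpow_mul hq.le]; norm_num [gam]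
  refine ⟨(r / ρ) ^ (1 / 5 : ℝ), by positivity, by rw [h5]; field_simp, ?_⟩
  rw [h7]
  calc C * r ^ gam = C * ρ ^ gam * (r / ρ) ^ gam := by
        rw [mul_assoc, ← Real.mul_rpow hρ.le hq.le, mul_div_cancel₀ _ hρ.ne']
    _ ≤ p * (r / ρ) ^ gam := by gcongr

/-- The intermediate state of the Lax–Friedrichs approximate Riemann solver with left state `U`
and right state `V`, up to orientation. -/
def interState (lam : ℝ) (U V : State) : State :=
  (2 * lam)⁻¹ • (lam • U + flux U + (lam • V - flux V))

theorem two_mul_interState {lam : ℝ} (hlam : lam ≠ 0) (U V : State) (i : Fin 3) :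
    2 * lam * interState lam U V i = lam * U i + flux U i + (lam * V i - flux V i) := by
  simp only [interState, Pi.smul_apply, Pi.add_apply, Pi.sub_apply, smul_eq_mul]
  field_simp

theorem flux_zero (U : State) : flux U 0 = density U * velocity U := rfl

theorem flux_one (U : State) : flux U 1 = density U * velocity U ^ 2 + pressure U := rfl

theorem flux_two (U : State) : flux U 2 = velocity U * (U 2 + pressure U) := rfl

/-- Multiplied by 2λ, the mixture is the sum of two streams with mass fluxes (λ + u_U)ρ_U and (λ −
u_V)ρ_V; `energy_inequality` divided by (2λ)² is the pressure bound. -/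
theorem interState_mem {C lam : ℝ} (hC : 0 < C) {U V : State} (hU : U ∈ entropySet C)
    (hV : V ∈ entropySet C) (hUlam : waveSpeed U ≤ lam) (hVlam : waveSpeed V ≤ lam) :
    interState lam U V ∈ entropySet C := by
  have adm : ∀ {U}, U ∈ entropySet C → Admissible U := fun {U} h =>
    ⟨h.1, lt_of_lt_of_le (mul_pos hC (Real.rpow_pos_of_pos h.1 _)) h.2⟩
  have cU := soundSpeed_pos (adm hU)
  have cV := soundSpeed_pos (adm hV)
  obtain ⟨hU0, hUp⟩ := id hU
  obtain ⟨hV0, hVp⟩ := id hV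
  have hlam : 0 < lam := lt_of_lt_of_le (by unfold waveSpeed; positivity) hUlam
  have hd : 2 * lam * density (interState lam U V)
      = (lam + velocity U) * density U + (lam - velocity V) * density V := by
    rw [density, two_mul_interState hlam.ne', flux_zero, flux_zero]
    simp only [density]
    ring
  have h1 : 2 * lam * interState lam U V 1 = (lam + velocity U) * (density U * velocity U)
      + pressure U + ((lam - velocity V) * (density V * velocity V) - pressure V) := by
    have eU : U 1 = density U * velocity U := by
      have : U 0 ≠ 0 := hU0.ne'
      simp only [density, velocity]; field_simp
    have eV : V 1 = density V * velocity V := by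
      have : V 0 ≠ 0 := hV0.ne'
      simp only [density, velocity]; field_simp
    rw [two_mul_interState hlam.ne', flux_one, flux_one, eU, eV]
    ring
  have h2 : 2 * lam * interState lam U V 2 = (lam + velocity U) *
      (5 / 2 * pressure U + density U * velocity U ^ 2 / 2) + pressure U * velocity U
      + ((lam - velocity V) * (5 / 2 * pressure V + density V * velocity V ^ 2 / 2)
        - pressure V * velocity V) := by
    have eU : U 2 = 5 / 2 * pressure U + density U * velocity U ^ 2 / 2 := by
      simp only [pressure, gam]; ring
    have eV : V 2 = 5 / 2 * pressure V + density V * velocity V ^ 2 / 2 := by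
      simp only [pressure, gam]; ring
    rw [two_mul_interState hlam.ne', flux_two, flux_two, eU, eV]
    ring
  have hr : 0 < density (interState lam U V) := by
    have a1 := (abs_le.1 (show |velocity U| ≤ lam - soundSpeed U by
      unfold waveSpeed at hUlam; linarith)).1
    have a2 := (abs_le.1 (show |velocity V| ≤ lam - soundSpeed V by
      unfold waveSpeed at hVlam; linarith)).2
    have b1 : 0 < (lam + velocity U) * density U := mul_pos (by linarith) hU0
    have b2 : 0 < (lam - velocity V) * density V := mul_pos (by linarith) hV0
    have : 0 < 2 * lam * density (interState lam U V) := by rw [hd]; positivity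
    exact (pos_iff_pos_of_mul_pos this).1 (by positivity)
  refine ⟨hr, ?_⟩
  obtain ⟨v, hv, hvr, hPv⟩ := exists_expansion hr hU0 hUp
  obtain ⟨w, hw, hwr, hPw⟩ := exists_expansion hr hV0 hVp
  have key := energy_inequality hU0 hV0 cU cV (soundSpeed_sq_mul (adm hU))
    (soundSpeed_sq_mul (adm hV)) hUlam hVlam hr
    (mul_pos hC (Real.rpow_pos_of_pos hr gam)) hd hv hw hvr hwr hPv hPw
  rw [← h1, ← h2] at key
  rw [pressure_eq hr]
  change 0 < interState lam U V 0 at hr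
  simp only [density] at key ⊢
  generalize interState lam U V 0 = r at *
  generalize interState lam U V 1 = m at *
  generalize interState lam U V 2 = E at *
  generalize C * r ^ gam = P at *
  have hl2 : 0 < (2 * lam) ^ 2 := by positivity
  have : r * (5 / 2 * P) + m ^ 2 / 2 ≤ r * E :=
    le_of_mul_le_mul_left (by linarith) hl2
  have e : E - m ^ 2 / (2 * r) = (r * E - m ^ 2 / 2) / r := by field_simp
  rw [e]
  have : 5 / 2 * P ≤ (r * E - m ^ 2 / 2) / r := by
    rw [le_div_iff₀ hr]; linarith
  linarith

theorem mem_entropySet_iff {s s₀ : ℝ} {U : State} :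
    U ∈ entropySet (Real.exp (s - s₀)) ↔ Admissible U ∧ s ≤ entropy s₀ U := by
  have aux : 0 < density U → 0 < pressure U →
      (Real.exp (s - s₀) * density U ^ gam ≤ pressure U ↔ s ≤ entropy s₀ U) := by
    intro h1 h2
    rw [← Real.log_le_log_iff (by positivity) h2, Real.log_mul (by positivity) (by positivity),
      Real.log_exp, Real.log_rpow h1, entropy]
    constructor <;> intro h <;> linarith
  constructor
  · rintro ⟨h1, h2⟩
    have hp : 0 < pressure U := lt_of_lt_of_le (by positivity) h2
    exact ⟨⟨h1, hp⟩, (aux h1 hp).1 h2⟩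
  · rintro ⟨⟨h1, h2⟩, h3⟩
    exact ⟨h1, (aux h1 h2).2 h3⟩

/-! ### Continuity of the gas quantities -/

section Continuity

variable {X : Type*} [TopologicalSpace X] {U : X → State} {S : Set X}

theorem continuousOn_velocity (hU : ContinuousOn U S) (hρ : ∀ x ∈ S, 0 < density (U x)) :
    ContinuousOn (fun x => velocity (U x)) S :=
  ((continuous_apply 1).comp_continuousOn hU).div ((continuous_apply 0).comp_continuousOn hU)
    fun x hx => (hρ x hx).ne'

theorem continuousOn_pressure (hU : ContinuousOn U S) (hρ : ∀ x ∈ S, 0 < density (U x)) :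
    ContinuousOn (fun x => pressure (U x)) S := by
  have h0 := (continuous_apply 0).comp_continuousOn hU
  have h2 := (continuous_apply 2).comp_continuousOn hU
  have hv := continuousOn_velocity hU hρ
  exact continuousOn_const.mul (h2.sub ((h0.mul (hv.pow 2)).div_const 2))

theorem continuousOn_flux (hU : ContinuousOn U S) (hρ : ∀ x ∈ S, 0 < density (U x)) :
    ContinuousOn (fun x => flux (U x)) S := by
  have h0 := (continuous_apply 0).comp_continuousOn hU
  have h2 := (continuous_apply 2).comp_continuousOn hU
  have hv := continuousOn_velocity hU hρ
  have hp := continuousOn_pressure hU hρ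
  refine continuousOn_pi.2 fun i => ?_
  fin_cases i
  · exact h0.mul hv
  · exact (h0.mul (hv.pow 2)).add hp
  · exact hv.mul (h2.add hp)

theorem continuousOn_entropy (s₀ : ℝ) (hU : ContinuousOn U S)
    (hadm : ∀ x ∈ S, Admissible (U x)) : ContinuousOn (fun x => entropy s₀ (U x)) S := by
  have hρ : ∀ x ∈ S, 0 < density (U x) := fun x hx => (hadm x hx).1
  have h0 : ContinuousOn (fun x => density (U x)) S := (continuous_apply 0).comp_continuousOn hU
  have hp := continuousOn_pressure hU hρ
  exact ((hp.log fun x hx => (hadm x hx).2.ne').sub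
    (continuousOn_const.mul (h0.log fun x hx => (hρ x hx).ne'))).add continuousOn_const

end Continuity

/-! ### Interpolation, quadrature and the element average -/

section Galerkin

variable {Np Nq : ℕ} {φ : Fin Np → ℝ[X]}

theorem continuous_dgField (c : Fin Np → State) : Continuous (dgField φ c) :=
  continuous_finsetSum _ fun m _ => (φ m).continuous.smul continuous_const

theorem exists_sum_eq_one (hone : (1 : ℝ[X]) ∈ Submodule.span ℝ (Set.range φ)) :
    ∃ a : Fin Np → ℝ, ∑ m, a m • φ m = 1 :=
  (Submodule.mem_span_range_iff_exists_fun ℝ).1 hone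

theorem sum_eval_eq_one {a : Fin Np → ℝ} (ha : ∑ m, a m • φ m = 1) (x : ℝ) :
    ∑ m, a m * (φ m).eval x = 1 := by
  simpa [eval_finsetSum] using congrArg (eval x) ha

theorem sum_eval_derivative_eq_zero {a : Fin Np → ℝ} (ha : ∑ m, a m • φ m = 1) (x : ℝ) :
    ∑ m, a m * (derivative (φ m)).eval x = 0 := by
  simpa [eval_finsetSum] using congrArg (fun p => eval x (derivative p)) ha

theorem cellAverage_dgField (xl xr : ℝ) (c : Fin Np → State) :
    cellAverage xl xr (dgField φ c)
      = ∑ m, ((xr - xl)⁻¹ * ∫ x in xl..xr, (φ m).eval x) • c m := by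
  unfold cellAverage dgField
  have hint : ∀ m ∈ Finset.univ,
      IntervalIntegrable (fun x => (φ m).eval x • c m) volume xl xr := fun m _ =>
    ((φ m).continuous.smul continuous_const).intervalIntegrable _ _
  rw [intervalIntegral.integral_finsetSum hint]
  simp only [intervalIntegral.integral_smul_const, Finset.smul_sum, smul_smul]

theorem sum_smul_dgField (Q : Fin Nq → ℝ) (x : Fin Nq → ℝ) (c : Fin Np → State) :
    ∑ q, Q q • dgField φ c (x q) = ∑ m, (∑ q, Q q * (φ m).eval (x q)) • c m := by
  simp only [dgField, Finset.smul_sum, smul_smul, Finset.sum_smul]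
  exact Finset.sum_comm

/-- Interpolation is exact on the span; the sum over all quadrature points collapses to the selected
ones. -/
theorem sum_quadBasis_mul {xq : Fin Nq → ℝ} {ι : Fin Np → Fin Nq}
    (hι : IsUnit (nodalMatrix φ (xq ∘ ι)).det) (m : Fin Np) (x : ℝ) :
    ∑ q, quadBasis φ xq ι q x * (φ m).eval (xq q) = (φ m).eval x := by
  have h : (nodalMatrix φ (xq ∘ ι)).mulVec (fun n => lagrangeBasis φ (xq ∘ ι) n x)
      = fun m => (φ m).eval x := by
    change (nodalMatrix φ (xq ∘ ι)).mulVec ((nodalMatrix φ (xq ∘ ι))⁻¹.mulVec _) = _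
    rw [Matrix.mulVec_mulVec, Matrix.mul_nonsing_inv _ hι, Matrix.one_mulVec]
  rw [← congrFun h m]
  simp only [quadBasis, Finset.sum_mul, ite_mul, zero_mul]
  rw [Finset.sum_comm]
  simp [Matrix.mulVec, dotProduct, nodalMatrix, mul_comm]

theorem sum_quadBasis {xq : Fin Nq → ℝ} {ι : Fin Np → Fin Nq}
    (hone : (1 : ℝ[X]) ∈ Submodule.span ℝ (Set.range φ))
    (hι : IsUnit (nodalMatrix φ (xq ∘ ι)).det) (x : ℝ) :
    ∑ q, quadBasis φ xq ι q x = 1 := by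
  obtain ⟨a, ha⟩ := exists_sum_eq_one hone
  rw [← sum_eval_eq_one ha x]
  simp only [← sum_quadBasis_mul hι _ x]
  calc ∑ q, quadBasis φ xq ι q x
      = ∑ q, quadBasis φ xq ι q x * ∑ m, a m * (φ m).eval (xq q) := by
        simp [sum_eval_eq_one ha]
    _ = _ := by
        simp only [Finset.mul_sum]
        rw [Finset.sum_comm]
        refine Finset.sum_congr rfl fun m _ => Finset.sum_congr rfl fun q _ => by ring

theorem sum_quadBasis_smul {xq : Fin Nq → ℝ} {ι : Fin Np → Fin Nq}
    (hι : IsUnit (nodalMatrix φ (xq ∘ ι)).det) (c : Fin Np → State) (x : ℝ) :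
    ∑ q, quadBasis φ xq ι q x • dgField φ c (xq q) = dgField φ c x := by
  rw [sum_smul_dgField]
  simp only [sum_quadBasis_mul hι]
  rfl

theorem sum_thetaQ {xl xr : ℝ} {w xq : Fin Nq → ℝ} {ι : Fin Np → Fin Nq}
    (hone : (1 : ℝ[X]) ∈ Submodule.span ℝ (Set.range φ))
    (hι : IsUnit (nodalMatrix φ (xq ∘ ι)).det) (hw : ∑ q, w q = 1) (θl θr : ℝ) :
    ∑ q, thetaQ xl xr φ w xq ι θl θr q = 1 - θl - θr := by
  simp only [thetaQ, Finset.sum_sub_distrib, ← Finset.mul_sum, sum_quadBasis hone hι, hw, mul_one]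

/-- The element average as a combination of the values at the quadrature points and at the
two interfaces. -/
theorem cellAverage_eq_sum_thetaQ {xl xr : ℝ} {w xq : Fin Nq → ℝ} {ι : Fin Np → Fin Nq}
    (hquad : IsQuadrature xl xr φ w xq) (hι : IsUnit (nodalMatrix φ (xq ∘ ι)).det)
    (c : Fin Np → State) (θl θr : ℝ) :
    cellAverage xl xr (dgField φ c)
      = ∑ q, thetaQ xl xr φ w xq ι θl θr q • dgField φ c (xq q)
        + θl • dgField φ c xl + θr • dgField φ c xr := by
  rw [cellAverage_dgField]
  simp only [hquad.exact]
  rw [← sum_smul_dgField]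
  -- Interpolation turns the subtracted Lagrange sums into the two traces, which the added trace
  -- terms cancel.
  simp only [thetaQ, sub_smul, mul_smul, Finset.sum_sub_distrib, ← Finset.smul_sum,
    sum_quadBasis_smul hι]
  abel

/-- The evolution of the element average under a forward Euler step. -/
theorem cellAverage_step {xl xr : ℝ} (hx : xl < xr)
    (hone : (1 : ℝ[X]) ∈ Submodule.span ℝ (Set.range φ)) {c c' : Fin Np → State}
    (hρ : ∀ x ∈ Set.Icc xl xr, 0 < density (dgField φ c x)) {UL UR : State}
    {lamL lamR dt : ℝ} (hdt : 0 < dt)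
    (hstep : IsForwardEulerStep xl xr φ UL UR lamL lamR dt c c') :
    cellAverage xl xr (dgField φ c') = cellAverage xl xr (dgField φ c)
      - (dt / (xr - xl)) • (laxFriedrichs lamL (dgField φ c xl) UL (-1)
        + laxFriedrichs lamR (dgField φ c xr) UR 1) := by
  obtain ⟨a, ha⟩ := exists_sum_eq_one hone
  have hF := continuousOn_flux (continuous_dgField (φ := φ) c).continuousOn hρ
  -- The difference quotient is kept opaque, so that distributing scalars does not split it.
  obtain ⟨X, hX⟩ : ∃ X : Fin Np → State, ∀ m, X m = dt⁻¹ • (c' m - c m) := ⟨_, fun _ => rfl⟩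
  simp only [IsForwardEulerStep, ← hX] at hstep
  have h1 : ∑ n, a n • ∑ m, (∫ x in xl..xr, (φ n).eval x * (φ m).eval x) • X m
      = ∑ m, (∫ x in xl..xr, (φ m).eval x) • X m := by
    simp only [Finset.smul_sum, smul_smul]
    rw [Finset.sum_comm]
    refine Finset.sum_congr rfl fun m _ => ?_
    rw [← Finset.sum_smul]
    congr 1
    simp only [← intervalIntegral.integral_const_mul]
    have hint : ∀ n ∈ Finset.univ, IntervalIntegrable
        (fun x => a n * ((φ n).eval x * (φ m).eval x)) volume xl xr := fun n _ =>
      (continuous_const.mul ((φ n).continuous.mul (φ m).continuous)).intervalIntegrable _ _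
    rw [← intervalIntegral.integral_finsetSum hint]
    congr 1
    ext x
    simp only [← mul_assoc]
    rw [← Finset.sum_mul, sum_eval_eq_one ha, one_mul]
  have h2 : ∑ n, a n • ∫ x in xl..xr, (derivative (φ n)).eval x • flux (dgField φ c x) = 0 := by
    simp only [← intervalIntegral.integral_smul]
    rw [← intervalIntegral.integral_finsetSum fun n _ => ?_]
    · simp only [smul_smul, ← Finset.sum_smul, sum_eval_derivative_eq_zero ha, zero_smul,
        intervalIntegral.integral_zero]
    · apply ContinuousOn.intervalIntegrable
      rw [Set.uIcc_of_le hx.le]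
      exact ((derivative (φ n)).continuous.continuousOn.smul hF).const_smul (a n)
  have h3 : ∀ (x : ℝ) (V : State), ∑ n, a n • (φ n).eval x • V = V := by
    intro x V
    simp only [smul_smul, ← Finset.sum_smul, sum_eval_eq_one ha, one_smul]
  have h := Finset.sum_congr rfl fun n (_ : n ∈ Finset.univ) => congrArg (a n • ·) (hstep n)
  simp only [smul_add, smul_sub, Finset.sum_add_distrib, Finset.sum_sub_distrib, smul_zero,
    Finset.sum_const_zero] at h h1
  rw [h2, h3, h3, h1, sub_zero] at h
  have hc' : ∀ m, c' m = c m + dt • X m := fun m => by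
    rw [hX, smul_inv_smul₀ hdt.ne', add_sub_cancel]
  have hsum : ∑ m, ((xr - xl)⁻¹ * ∫ x in xl..xr, (φ m).eval x) • dt • X m
      = (dt / (xr - xl)) • ∑ m, (∫ x in xl..xr, (φ m).eval x) • X m := by
    rw [Finset.smul_sum]
    refine Finset.sum_congr rfl fun m _ => ?_
    rw [smul_smul, smul_smul]
    congr 1
    ring
  rw [cellAverage_dgField, cellAverage_dgField]
  simp only [hc', smul_add, Finset.sum_add_distrib]
  rw [hsum, eq_neg_of_add_eq_zero_left h, smul_neg, ← sub_eq_add_neg, smul_add]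

end Galerkin

/-! ### The convex decomposition of the updated average -/

theorem smul_interState {lam : ℝ} (hlam : lam ≠ 0) (k : ℝ) (U V : State) :
    (2 * k * lam) • interState lam U V = k • (lam • U + flux U + (lam • V - flux V)) := by
  rw [interState, smul_smul]
  congr 1
  field_simp

/-- The intermediate states at the two interfaces leave over 2k(F(Ul) − F(Ur)). The artificial state
between the interior traces, with doubled weight, absorbs exactly this. -/
theorem interface_decomposition {lamL lamR lam : ℝ} (hL : lamL ≠ 0) (hR : lamR ≠ 0)
    (h : lam ≠ 0) (k θl θr : ℝ) (UL Ul Ur UR : State) :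
    θl • Ul + θr • Ur - (2 * k) • (laxFriedrichs lamL Ul UL (-1) + laxFriedrichs lamR Ur UR 1)
      = (2 * k * lamL) • interState lamL UL Ul + (2 * k * lamR) • interState lamR Ur UR
        + (2 * (2 * k) * lam) • interState lam Ul Ur
        + (θl - 2 * k * lamL - 2 * k * lam) • Ul + (θr - 2 * k * lamR - 2 * k * lam) • Ur := by
  rw [smul_interState hL, smul_interState hR, smul_interState h]
  unfold laxFriedrichs
  module

/-- A state decomposed into point values in `S` and Lax–Friedrichs interface contributions lies
in the convex set of states with a given entropy bound. -/
theorem decomposition_mem {C : ℝ} (hC : 0 < C) {Nq : ℕ} {θ : Fin Nq → ℝ} {U : Fin Nq → State}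
    (hθ : ∀ q, 0 ≤ θ q) (hU : ∀ q, U q ∈ entropySet C) {UL Ul Ur UR : State}
    (hUL : UL ∈ entropySet C) (hUl : Ul ∈ entropySet C) (hUr : Ur ∈ entropySet C)
    (hUR : UR ∈ entropySet C) {θl θr k lamL lamR lam : ℝ} (hsum : ∑ q, θ q + θl + θr = 1)
    (hk : 0 ≤ k) (hlamL : max (waveSpeed UL) (waveSpeed Ul) ≤ lamL)
    (hlamR : max (waveSpeed Ur) (waveSpeed UR) ≤ lamR) (hlam : max lamL lamR ≤ lam)
    (hL : 0 < lamL) (hR : 0 < lamR)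
    (hθl : 4 * k * lam ≤ θl) (hθr : 4 * k * lam ≤ θr) :
    ∑ q, θ q • U q + θl • Ul + θr • Ur
      - (2 * k) • (laxFriedrichs lamL Ul UL (-1) + laxFriedrichs lamR Ur UR 1) ∈ entropySet C := by
  obtain ⟨hL1, hL2⟩ := max_le_iff.1 hlamL
  obtain ⟨hR1, hR2⟩ := max_le_iff.1 hlamR
  obtain ⟨h1, h2⟩ := max_le_iff.1 hlam
  have hl : 0 < lam := hL.trans_le h1
  -- Since λ_L, λ_R ≤ λ, the remaining trace weights are at least θ − 4kλ ≥ 0.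
  have e1 : k * lamL ≤ k * lam := by gcongr
  have e2 : k * lamR ≤ k * lam := by gcongr
  have key := (convex_entropySet hC.le).sum_mem (t := Finset.univ)
    (w := Sum.elim θ ![2 * k * lamL, 2 * k * lamR, 2 * (2 * k) * lam,
      θl - 2 * k * lamL - 2 * k * lam, θr - 2 * k * lamR - 2 * k * lam])
    (z := Sum.elim U ![interState lamL UL Ul, interState lamR Ur UR, interState lam Ul Ur, Ul, Ur])
    (by
      rintro (q | i) -
      · exact hθ q
      · fin_cases i <;> simp <;> first | positivity | linarith)
    (by
      rw [Fintype.sum_sum_type, Fin.sum_univ_five]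
      simp
      linarith)
    (by
      rintro (q | i) -
      · exact hU q
      · fin_cases i
        · exact interState_mem hC hUL hUl hL1 hL2
        · exact interState_mem hC hUr hUR hR1 hR2
        · exact interState_mem hC hUl hUr (hL2.trans h1) (hR1.trans h2)
        · exact hUl
        · exact hUr)
  rw [Fintype.sum_sum_type, Fin.sum_univ_five] at key
  have hd := interface_decomposition hL.ne' hR.ne' hl.ne' k θl θr UL Ul Ur UR
  rw [add_assoc, add_sub_assoc, hd]
  exact key

end EntropyDG

end

theorem lemma3
    -- the element, its polynomial space (which contains the constants) and the solution on it
    (xl xr : ℝ) (hx : xl < xr)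
    {Np : ℕ} (φ : Fin Np → ℝ[X]) (hone : (1 : ℝ[X]) ∈ Submodule.span ℝ (Set.range φ))
    (c : Fin Np → EntropyDG.State)
    (hadm : ∀ x ∈ Set.Icc xl xr, EntropyDG.Admissible (EntropyDG.dgField φ c x))
    -- the exterior traces at the two interfaces
    (UL UR : EntropyDG.State)
    (hUL : EntropyDG.Admissible UL) (hUR : EntropyDG.Admissible UR)
    -- the quadrature rule and the interpolation points chosen among its points
    {Nq : ℕ} (w xq : Fin Nq → ℝ) (hquad : EntropyDG.IsQuadrature xl xr φ w xq)
    (ι : Fin Np → Fin Nq) (hι : IsUnit (EntropyDG.nodalMatrix φ (xq ∘ ι)).det)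
    -- the convex decomposition of the average
    (θl θr : ℝ) (hθl : 0 < θl) (hθr : 0 < θr)
    (hθq : ∀ q, 0 ≤ EntropyDG.thetaQ xl xr φ w xq ι θl θr q)
    -- the dissipation coefficients of the two interface fluxes and the wave speed bound
    (lamL lamR lam : ℝ)
    (hlamL : max (EntropyDG.waveSpeed UL)
      (EntropyDG.waveSpeed (EntropyDG.dgField φ c xl)) ≤ lamL)
    (hlamR : max (EntropyDG.waveSpeed (EntropyDG.dgField φ c xr))
      (EntropyDG.waveSpeed UR) ≤ lamR)
    (hlam : max lamL lamR ≤ lam)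
    -- the time step and the CFL constraint
    (dt : ℝ) (hdt : 0 < dt) (hCFL : dt * lam / (xr - xl) ≤ 1 / 2 * min θl θr)
    -- the updated solution
    (c' : Fin Np → EntropyDG.State)
    (hstep : EntropyDG.IsForwardEulerStep xl xr φ UL UR lamL lamR dt c c')
    -- the reference entropy
    (s₀ : ℝ) :
    EntropyDG.Admissible (EntropyDG.cellAverage xl xr (EntropyDG.dgField φ c')) ∧
      ∃ sMin : ℝ,
        IsLeast (EntropyDG.entropy s₀ ''
          (EntropyDG.dgField φ c '' Set.Icc xl xr ∪ {UL, UR})) sMin ∧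
        sMin ≤ EntropyDG.entropy s₀ (EntropyDG.cellAverage xl xr (EntropyDG.dgField φ c')) := by
  have hl : xl ∈ Set.Icc xl xr := Set.left_mem_Icc.2 hx.le
  have hr : xr ∈ Set.Icc xl xr := Set.right_mem_Icc.2 hx.le
  have hcont := (EntropyDG.continuous_dgField (φ := φ) c).continuousOn (s := Set.Icc xl xr)
  have hadm' : ∀ U ∈ EntropyDG.dgField φ c '' Set.Icc xl xr ∪ {UL, UR}, EntropyDG.Admissible U := by
    rintro U (⟨x, hx, rfl⟩ | rfl | rfl)
    exacts [hadm x hx, hUL, hUR]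
  have hcomp : IsCompact (EntropyDG.dgField φ c '' Set.Icc xl xr ∪ {UL, UR}) :=
    (isCompact_Icc.image_of_continuousOn hcont).union (Set.toFinite _).isCompact
  -- The entropy is continuous on a compact set of admissible states, so the minimum is attained.
  obtain ⟨sMin, hmin⟩ := (hcomp.image_of_continuousOn
    (EntropyDG.continuousOn_entropy s₀ continuousOn_id hadm')).exists_isLeast
      (Set.Nonempty.image _ ⟨UL, Or.inr (Or.inl rfl)⟩)
  have hmem : ∀ U ∈ EntropyDG.dgField φ c '' Set.Icc xl xr ∪ {UL, UR},
      U ∈ EntropyDG.entropySet (Real.exp (sMin - s₀)) := fun U hU =>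
    EntropyDG.mem_entropySet_iff.2 ⟨hadm' U hU, hmin.2 ⟨U, hU, rfl⟩⟩
  have hmemx : ∀ x ∈ Set.Icc xl xr, EntropyDG.dgField φ c x ∈ EntropyDG.entropySet (Real.exp (sMin - s₀)) :=
    fun x hx => hmem _ (Or.inl ⟨x, hx, rfl⟩)
  have hw : ∀ {U}, EntropyDG.Admissible U → 0 < EntropyDG.waveSpeed U := fun {U} hU =>
    add_pos_of_nonneg_of_pos (abs_nonneg _) (EntropyDG.soundSpeed_pos hU)
  have hh : 0 < xr - xl := sub_pos.2 hx
  -- Here k = Δt/(2h), so 4kλ = 2Δtλ/h; this is where the factor 1/2 of the CFL condition is used.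
  have hk : 4 * (dt / (xr - xl) / 2) * lam ≤ min θl θr := by
    have : 4 * (dt / (xr - xl) / 2) * lam = 2 * (dt * lam / (xr - xl)) := by ring
    linarith
  have key := EntropyDG.decomposition_mem (Real.exp_pos (sMin - s₀)) hθq
    (fun q => hmemx _ (hquad.mem q)) (hmem UL (Or.inr (Or.inl rfl))) (hmemx xl hl) (hmemx xr hr)
    (hmem UR (Or.inr (Or.inr rfl)))
    (by rw [EntropyDG.sum_thetaQ hone hι hquad.sum_one]; ring) (k := dt / (xr - xl) / 2) (by positivity)
    hlamL hlamR hlam ((hw hUL).trans_le ((le_max_left _ _).trans hlamL))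
    ((hw hUR).trans_le ((le_max_right _ _).trans hlamR))
    (hk.trans (min_le_left _ _)) (hk.trans (min_le_right _ _))
  rw [← EntropyDG.cellAverage_eq_sum_thetaQ hquad hι, mul_div_cancel₀ _ two_ne_zero,
    ← EntropyDG.cellAverage_step hx hone (fun x hx => (hadm x hx).1) hdt hstep] at key
  exact ⟨(EntropyDG.mem_entropySet_iff.1 key).1, sMin, hmin, (EntropyDG.mem_entropySet_iff.1 key).2⟩
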